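/- Tile $\mathbb{R}^2$ by the open unit squares with sides parallel to the axes and centres in $\mathbb{Z}^2$ (they cover the plane up to their edges), and let $S_0$ be the square centred at the origin. Every square is either occupied or vacant. Two distinct squares are star-adjacent if they share a corner. Let $C(0)$ be the set of occupied squares that can be reached from $S_0$ through a sequence of successively star-adjacent occupied squares, starting with $S_0$ (so $C(0)=\emptyset$ if $S_0$ is vacant). Let $G_C$ be the graph whose vertices and edges are the corners and edges of the squares of $C(0)$. An edge of $G_C$ is a boundary edge if it is an edge of some occupied square and of some vacant square. The interior (exterior) of a cycle in $G_C$ is the bounded (unbounded) part of its complement in $\mathbb{R}^2$; an edge lies in the exterior of a cycle if it does so without its endpoints. Cycles are regarded as subgraphs, that is, up to starting point and direction. The outermost boundary $\partial_0$ is the set of all edges $e$ of $G_C$ such that, for every cycle $C$ in $G_C$, either $e$ is an edge of $C$ or $e$ lies in the exterior of $C$. Theorem. Suppose that $C(0)$ is finite. Then there is exactly one finite set $\{C_1,\dots,C_n\}$ of cycles in $G_C$ such that $\partial_0$ is the set of all edges of $C_1\cup\dots\cup C_n$ and the following hold: (i) the graph $\bigcup_{1\le i\le n} C_i$ is connected (if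 $C(0)=\emptyset$, then $n=0$ and it is the empty graph); (ii) if $i\neq j$, then $C_i$ and $C_j$ have disjoint interiors and share at most one vertex; (iii) every square of $C(0)$ is contained in the interior of some $C_j$; (iv) every edge of each $C_j$ is a boundary edge; it is an edge of an occupied square of $C(0)$ contained in the interior of $C_j$ and of a vacant square contained in the exterior of $C_j$. Moreover, if $C(0)\neq\emptyset$, there is a circuit in $G_C$, that is, a closed walk that repeats no edge, whose edges are exactly the edges of $\bigcup_{1\le i\le n} C_i$ (an Eulerian circuit of this graph). -/

import Mathlib

namespace StarPercolation

noncomputable section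

/-- The plane. -/
abbrev Plane := ℝ × ℝ

/-- The unit squares tiling the plane: the index `(i, j)` stands for the unit square with
centre `(i, j)`, so that `0` is the square centred at the origin. -/
abbrev Square := ℤ × ℤ

/-- The corners of the squares: the index `(a, b)` stands for the point
`(a - 1/2, b - 1/2)` of the plane. -/
abbrev Corner := ℤ × ℤ

/-- The point of the plane given by a corner. -/
def Corner.point (v : Corner) : Plane := ((v.1 : ℝ) - 1 / 2, (v.2 : ℝ) - 1 / 2)

/-- The (open) unit square with centre `(i, j)`. -/
def openSquare (k : Square) : Set Plane :=
  Set.Ioo ((k.1 : ℝ) - 1 / 2) ((k.1 : ℝ) + 1 / 2) ×ˢ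
    Set.Ioo ((k.2 : ℝ) - 1 / 2) ((k.2 : ℝ) + 1 / 2)

/-- The four corners of a square. -/
def corners (k : Square) : Set Corner :=
  {(k.1, k.2), (k.1 + 1, k.2), (k.1 + 1, k.2 + 1), (k.1, k.2 + 1)}

/-- The four edges of a square. -/
def squareEdges (k : Square) : Set (Sym2 Corner) :=
  {s((k.1, k.2), (k.1 + 1, k.2)), s((k.1 + 1, k.2), (k.1 + 1, k.2 + 1)),
    s((k.1 + 1, k.2 + 1), (k.1, k.2 + 1)), s((k.1, k.2 + 1), (k.1, k.2))}

/-- Two different squares are star-adjacent if they share a corner. -/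
def StarAdj (k l : Square) : Prop := k ≠ l ∧ (corners k ∩ corners l).Nonempty

/-- The occupied star-connected component `C(0)` of the origin, where `occ` is the set of
occupied squares and all other squares are vacant. It is empty if the square centred at the
origin is vacant. -/
def component (occ : Set Square) : Set Square :=
  {k | (0 : Square) ∈ occ ∧
    Relation.ReflTransGen (fun a b => a ∈ occ ∧ b ∈ occ ∧ StarAdj a b) 0 k}

/-- The graph `G_C`, whose edges are the edges of the squares of `C(0)`. (Corners that belong to
no square of `C(0)` are isolated vertices here; no cycle or circuit visits them.) -/
def compGraph (occ : Set Square) : SimpleGraph Corner :=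
  SimpleGraph.fromEdgeSet {e | ∃ k ∈ component occ, e ∈ squareEdges k}

/-- The closed segment in the plane that is spanned by an edge. -/
def closedEdge : Sym2 Corner → Set Plane :=
  Sym2.lift ⟨fun u v => segment ℝ (Corner.point u) (Corner.point v),
    fun _ _ => segment_symm ℝ _ _⟩

/-- The segment in the plane that is spanned by an edge, without its endpoints. -/
def openEdge : Sym2 Corner → Set Plane :=
  Sym2.lift ⟨fun u v => openSegment ℝ (Corner.point u) (Corner.point v),
    fun _ _ => openSegment_symm ℝ _ _⟩

section Cycles

variable {G : SimpleGraph Corner}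

/-- A subgraph of `G` is a cycle if it consists of the vertices and edges of a closed walk that
repeats no edge and no vertex, except that it ends where it starts. So two sequences of vertices
that differ in the starting point or the direction are the same cycle. -/
def IsCycle (H : G.Subgraph) : Prop :=
  ∃ (v : Corner) (p : G.Walk v v), p.IsCycle ∧ p.toSubgraph = H

/-- The set of points of the plane on the edges of a subgraph. -/
def trace (H : G.Subgraph) : Set Plane := ⋃ e ∈ H.edgeSet, closedEdge e

/-- The interior of a cycle: the points off the cycle whose connected component in the
complement of the cycle is bounded. -/
def cycleInterior (H : G.Subgraph) : Set Plane :=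
  {x | x ∉ trace H ∧ Bornology.IsBounded (connectedComponentIn (trace H)ᶜ x)}

/-- The exterior of a cycle: the points off the cycle whose connected component in the
complement of the cycle is unbounded. -/
def cycleExterior (H : G.Subgraph) : Set Plane :=
  {x | x ∉ trace H ∧ ¬ Bornology.IsBounded (connectedComponentIn (trace H)ᶜ x)}

end Cycles

/-- Boundary edges: edges of `G_C` adjacent to an occupied square and to a vacant square. -/
def IsBoundaryEdge (occ : Set Square) (e : Sym2 Corner) : Prop :=
  e ∈ (compGraph occ).edgeSet ∧ (∃ k, k ∈ occ ∧ e ∈ squareEdges k) ∧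
    ∃ l, l ∉ occ ∧ e ∈ squareEdges l

/-- The outermost boundary `∂₀`: the edges `e` of `G_C` such that, for every cycle in `G_C`,
either `e` is an edge of the cycle or `e` lies in the exterior of the cycle. -/
def outermostBoundary (occ : Set Square) : Set (Sym2 Corner) :=
  {e | e ∈ (compGraph occ).edgeSet ∧ ∀ H : (compGraph occ).Subgraph, IsCycle H →
    e ∈ H.edgeSet ∨ openEdge e ⊆ cycleExterior H}

/-- `𝒞` is a finite set of cycles in `G_C` whose union is the outermost boundary and which has
the four properties of an outermost boundary. -/
structure IsOutermostCycles (occ : Set Square) (𝒞 : Set (compGraph occ).Subgraph) : Prop where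
  finite : 𝒞.Finite
  isCycle : ∀ H ∈ 𝒞, IsCycle H
  /-- An edge is an outermost boundary edge iff it is an edge of one of the cycles. -/
  boundary_eq : outermostBoundary occ = ⋃ H ∈ 𝒞, H.edgeSet
  /-- The union of the cycles is connected (in the case `C(0) = ∅` it is the empty graph). -/
  connected : (component occ).Nonempty → (sSup 𝒞).Connected
  /-- Different cycles have disjoint interiors and share at most one vertex. -/
  disjoint : ∀ H ∈ 𝒞, ∀ H' ∈ 𝒞, H ≠ H' →
    Disjoint (cycleInterior H) (cycleInterior H') ∧ (H.verts ∩ H'.verts).Subsingleton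
  /-- Every square of `C(0)` is in the interior of one of the cycles. -/
  covers : ∀ k ∈ component occ, ∃ H ∈ 𝒞, openSquare k ⊆ cycleInterior H
  /-- Every edge of a cycle is a boundary edge, adjacent to an occupied square of `C(0)` in the
  interior and to a vacant square in the exterior of that cycle. -/
  edges : ∀ H ∈ 𝒞, ∀ e ∈ H.edgeSet, IsBoundaryEdge occ e ∧
    (∃ k ∈ component occ, e ∈ squareEdges k ∧ openSquare k ⊆ cycleInterior H) ∧
    ∃ l, l ∉ occ ∧ e ∈ squareEdges l ∧ openSquare l ⊆ cycleExterior H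

end

end StarPercolation

namespace StarPercolation

/-! Call a square outer if infinitely many squares can be reached from it without crossing an edge
of G_C. The edges between outer and non-outer squares are the outer edges, and a cell is the set of
squares that can be reached from a given non-outer square without crossing an outer edge. An outer
edge has an outer, vacant square on one side and a square of C(0) on the other. The cycles sought
are the boundaries of the cells of the squares of C(0).

No Jordan curve theorem is needed; parity replaces it. A closed lattice walk bounds, mod 2, a finite
set B of squares (`exists_finite_edgeBoundary_walk`). If the walk uses only outer edges, then B
contains no outer square and contains each cell entirely or not at all, so the walk traverses all
boundary edges of a given cell with the same parity (`odd_count_iff_of_mem_edgeBoundary_cell`). This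
has two consequences. The boundary of a cell has no vertex of degree one, so it contains a cycle,
and that cycle must use every edge of it (`exists_isCycle_edgeSet_eq`). If the cycles of two
different cells had two common vertices, an arc of one closed up by an arc of the other would
traverse only a part of a cell boundary (`subsingleton_inter_verts`).

Star-adjacent squares lie in one cell or in cells whose cycles touch, so the cycles form a connected
family and can be spliced into a single circuit (`exists_isCircuit_of_touching`).

Topologically, the squares of a cell lie in bounded components of the complement of its cycle
(`isBounded_squareComponent`), and all other squares can escape to infinity
(`not_isBounded_of_not_mem_cell`). This identifies the outermost boundary with the outer edges and
gives (i)-(iv). For uniqueness, the disjointness of interiors forces a cycle around a square of C(0)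
to contain the whole boundary of its cell, and a cycle contained in a cycle is equal to it. -/

/-! ### Lattice edges and boundaries of sets of squares -/

/-- The horizontal edge from the corner `(a, b)` to the corner `(a + 1, b)`. -/
def hEdge (a b : ℤ) : Sym2 Corner := s((a, b), (a + 1, b))

/-- The vertical edge from the corner `(a, b)` to the corner `(a, b + 1)`. -/
def vEdge (a b : ℤ) : Sym2 Corner := s((a, b), (a, b + 1))

/-- Edges of the square lattice. -/
def IsLatticeEdge (e : Sym2 Corner) : Prop := ∃ k, e ∈ squareEdges k

lemma mem_squareEdges_iff {e : Sym2 Corner} {k : Square} :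
    e ∈ squareEdges k ↔ e = hEdge k.1 k.2 ∨ e = vEdge (k.1 + 1) k.2 ∨
      e = hEdge k.1 (k.2 + 1) ∨ e = vEdge k.1 k.2 := by
  simp only [squareEdges, Set.mem_insert_iff, Set.mem_singleton_iff, hEdge, vEdge]
  rw [Sym2.eq_swap (a := (k.1 + 1, k.2 + 1)), Sym2.eq_swap (a := (k.1, k.2 + 1)) (b := (k.1, k.2))]

@[simp] lemma hEdge_inj {a b a' b' : ℤ} : hEdge a b = hEdge a' b' ↔ a = a' ∧ b = b' := by
  simp only [hEdge, Sym2.eq_iff, Prod.mk.injEq]; omega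

@[simp] lemma vEdge_inj {a b a' b' : ℤ} : vEdge a b = vEdge a' b' ↔ a = a' ∧ b = b' := by
  simp only [vEdge, Sym2.eq_iff, Prod.mk.injEq]; omega

@[simp] lemma hEdge_ne_vEdge {a b a' b' : ℤ} : hEdge a b ≠ vEdge a' b' := by
  simp only [hEdge, vEdge, ne_eq, Sym2.eq_iff, Prod.mk.injEq]; omega

@[simp] lemma vEdge_ne_hEdge {a b a' b' : ℤ} : vEdge a b ≠ hEdge a' b' := hEdge_ne_vEdge.symm

@[simp] lemma hEdge_mem_squareEdges {a b : ℤ} {k : Square} :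
    hEdge a b ∈ squareEdges k ↔ k = (a, b) ∨ k = (a, b - 1) := by
  obtain ⟨i, j⟩ := k
  simp only [mem_squareEdges_iff, hEdge_inj, hEdge_ne_vEdge, Prod.mk.injEq, false_or, or_false]; omega

@[simp] lemma vEdge_mem_squareEdges {a b : ℤ} {k : Square} :
    vEdge a b ∈ squareEdges k ↔ k = (a, b) ∨ k = (a - 1, b) := by
  obtain ⟨i, j⟩ := k
  simp only [mem_squareEdges_iff, vEdge_inj, vEdge_ne_hEdge, Prod.mk.injEq, false_or]; omega

lemma IsLatticeEdge.cases {e : Sym2 Corner} (h : IsLatticeEdge e) :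
    (∃ a b, e = hEdge a b) ∨ ∃ a b, e = vEdge a b := by
  obtain ⟨k, hk⟩ := h
  rcases mem_squareEdges_iff.1 hk with h | h | h | h <;> simp [h]

lemma IsLatticeEdge.exists_squares {e : Sym2 Corner} (h : IsLatticeEdge e) :
    ∃ k l, k ≠ l ∧ ∀ m, e ∈ squareEdges m ↔ m = k ∨ m = l := by
  rcases h.cases with ⟨a, b, rfl⟩ | ⟨a, b, rfl⟩
  · exact ⟨(a, b), (a, b - 1), by simp; omega, fun m => by simp⟩
  · exact ⟨(a, b), (a - 1, b), by simp; omega, fun m => by simp⟩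

/-- An edge borders only two squares. -/
lemma eq_or_eq_of_mem_squareEdges {e : Sym2 Corner} {k l m : Square} (hk : e ∈ squareEdges k)
    (hl : e ∈ squareEdges l) (hm : e ∈ squareEdges m) (hkl : k ≠ l) : m = k ∨ m = l := by
  obtain ⟨k', l', -, h⟩ := IsLatticeEdge.exists_squares ⟨k, hk⟩
  rw [h] at hk hl hm
  grind

/-- The edges between a set of squares and its complement. -/
def edgeBoundary (A : Set Square) : Set (Sym2 Corner) :=
  {e | (∃ k ∈ A, e ∈ squareEdges k) ∧ ∃ l ∉ A, e ∈ squareEdges l}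

lemma hEdge_mem_edgeBoundary {A : Set Square} {a b : ℤ} :
    hEdge a b ∈ edgeBoundary A ↔ ¬ ((a, b) ∈ A ↔ (a, b - 1) ∈ A) := by
  simp only [edgeBoundary, Set.mem_ofPred_eq, hEdge_mem_squareEdges]
  grind

lemma vEdge_mem_edgeBoundary {A : Set Square} {a b : ℤ} :
    vEdge a b ∈ edgeBoundary A ↔ ¬ ((a, b) ∈ A ↔ (a - 1, b) ∈ A) := by
  simp only [edgeBoundary, Set.mem_ofPred_eq, vEdge_mem_squareEdges]
  grind

lemma mem_edgeBoundary_iff {A : Set Square} {e : Sym2 Corner} {k l : Square}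
    (hk : e ∈ squareEdges k) (hl : e ∈ squareEdges l) (hkl : k ≠ l) :
    e ∈ edgeBoundary A ↔ ¬ (k ∈ A ↔ l ∈ A) := by
  constructor
  · rintro ⟨⟨m, hm, hm'⟩, n, hn, hn'⟩
    rcases eq_or_eq_of_mem_squareEdges hk hl hm' hkl with rfl | rfl <;>
    rcases eq_or_eq_of_mem_squareEdges hk hl hn' hkl with rfl | rfl <;> tauto
  · intro h
    by_cases h' : k ∈ A
    · exact ⟨⟨k, h', hk⟩, l, by tauto, hl⟩
    · exact ⟨⟨l, by tauto, hl⟩, k, h', hk⟩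

lemma isLatticeEdge_of_mem_edgeBoundary {A : Set Square} {e : Sym2 Corner}
    (h : e ∈ edgeBoundary A) : IsLatticeEdge e := by
  obtain ⟨⟨k, -, hk⟩, -⟩ := h
  exact ⟨k, hk⟩

lemma squareEdges_finite (k : Square) : (squareEdges k).Finite := by
  simp [squareEdges]

lemma edgeBoundary_finite {A : Set Square} (hA : A.Finite) : (edgeBoundary A).Finite :=
  (hA.biUnion fun k _ => squareEdges_finite k).subset fun _ he => by
    obtain ⟨⟨k, hk, hk'⟩, -⟩ := he
    exact Set.mem_biUnion hk hk'

/-! ### Regions of the complement of a set of edges -/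

/-- Two squares are linked off a set `D` of edges if they share an edge that is not in `D`. -/
def Step (D : Set (Sym2 Corner)) (k l : Square) : Prop :=
  ∃ e ∉ D, e ∈ squareEdges k ∧ e ∈ squareEdges l

/-- Two squares are in the same region of the complement of the set `D` of edges. -/
def Reach (D : Set (Sym2 Corner)) : Square → Square → Prop := Relation.ReflTransGen (Step D)

lemma Step.symm {D : Set (Sym2 Corner)} {k l : Square} (h : Step D k l) : Step D l k := by
  obtain ⟨e, he, hk, hl⟩ := h
  exact ⟨e, he, hl, hk⟩

lemma Reach.symm {D : Set (Sym2 Corner)} {k l : Square} (h : Reach D k l) : Reach D l k := by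
  induction h with
  | refl => exact Relation.ReflTransGen.refl
  | tail _ h ih => exact Relation.ReflTransGen.head h.symm ih

lemma Reach.mono {D D' : Set (Sym2 Corner)} (hD : D ⊆ D') {k l : Square} (h : Reach D' k l) :
    Reach D k l :=
  Relation.ReflTransGen.mono (fun _ _ ⟨e, he, h⟩ => ⟨e, fun h' => he (hD h'), h⟩) _ _ h

/-- A set of squares whose boundary edges are all in `D` is a union of regions. -/
lemma Reach.mem_iff {D : Set (Sym2 Corner)} {B : Set Square} (hB : edgeBoundary B ⊆ D)
    {k l : Square} (h : Reach D k l) : k ∈ B ↔ l ∈ B := by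
  induction h with
  | refl => rfl
  | @tail m n _ h ih =>
    obtain ⟨e, he, hm, hn⟩ := h
    rw [ih]
    by_contra h
    rcases eq_or_ne m n with rfl | hmn
    · exact h Iff.rfl
    · exact he (hB ((mem_edgeBoundary_iff hm hn hmn).2 h))

/-- The region of a square off a set of edges. -/
def region (D : Set (Sym2 Corner)) (k : Square) : Set Square := {l | Reach D k l}

lemma mem_region_self (D : Set (Sym2 Corner)) (k : Square) : k ∈ region D k :=
  Relation.ReflTransGen.refl

lemma region_eq {D : Set (Sym2 Corner)} {k l : Square} (h : Reach D k l) :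
    region D k = region D l := by
  ext m
  exact ⟨fun hm => h.symm.trans hm, fun hm => h.trans hm⟩

lemma edgeBoundary_region_subset (D : Set (Sym2 Corner)) (k : Square) :
    edgeBoundary (region D k) ⊆ D := by
  rintro e ⟨⟨m, hm, hm'⟩, l, hl, hl'⟩
  by_contra he
  exact hl (Relation.ReflTransGen.tail hm ⟨e, he, hm', hl'⟩)

/-- A nonempty finite set of squares has a boundary edge. -/
lemma edgeBoundary_nonempty {A : Set Square} (hA : A.Finite) (hne : A.Nonempty) :
    (edgeBoundary A).Nonempty := by
  obtain ⟨k, hk, hmax⟩ := hA.exists_maximalFor (fun k : Square => k.1) A hne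
  refine ⟨vEdge (k.1 + 1) k.2, ?_⟩
  rw [vEdge_mem_edgeBoundary]
  -- The square `k` is a rightmost one of `A`, so its right neighbour is not in `A`.
  have h1 : (k.1 + 1, k.2) ∉ A := fun h => by
    have := hmax h (by simp)
    simp at this
  simp [h1, hk]

/-! ### Closed walks bound mod 2 -/

open Finset in
/-- A mod 2 chain of lattice edges with zero boundary and bounded support is the boundary of a
finite set of squares. -/
lemma exists_finite_edgeBoundary_eq {c : Sym2 Corner → ZMod 2} {N : ℤ}
    (hh : ∀ a b, c (hEdge a b) ≠ 0 → |a| ≤ N ∧ |b| ≤ N)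
    (hv : ∀ a b, c (vEdge a b) ≠ 0 → |a| ≤ N ∧ |b| ≤ N)
    (hc : ∀ a b, c (hEdge a b) + c (hEdge (a - 1) b) + c (vEdge a b) + c (vEdge a (b - 1)) = 0) :
    ∃ B : Set Square, B.Finite ∧ ∀ e, IsLatticeEdge e → (e ∈ edgeBoundary B ↔ c e ≠ 0) := by
  have two : ∀ x : ZMod 2, x + x = 0 := CharTwo.add_self_eq_zero
  have hh' : ∀ a b, N < |a| ∨ N < |b| → c (hEdge a b) = 0 := fun a b h => by
    by_contra h'
    have := hh a b h'
    omega
  have hv' : ∀ a b, N < |a| ∨ N < |b| → c (vEdge a b) = 0 := fun a b h => by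
    by_contra h'
    have := hv a b h'
    omega
  -- `f a b` counts, mod 2, the vertical edges of the chain crossed on the way from the far left to
  -- the square `(a, b)`; by the bound `N` the sum may start at `-N`. The set wanted is where `f` is
  -- nonzero.
  set f : ℤ → ℤ → ZMod 2 := fun a b => ∑ x ∈ Ioc (-N - 1) a, c (vEdge x b) with hf
  have f_left : ∀ a b, a ≤ -N - 1 → f a b = 0 := fun a b h => by
    simp [hf, Ioc_eq_empty_of_le h]
  have f_step : ∀ a b, f a b = f (a - 1) b + c (vEdge a b) := fun a b => by
    rcases le_or_gt a (-N - 1) with h | h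
    · rw [f_left a b h, f_left (a - 1) b (by omega), hv' a b (by left; rw [lt_abs]; omega), add_zero]
    · have : Ioc (-N - 1) a = insert a (Ioc (-N - 1) (a - 1)) := by
        ext x; simp only [mem_Ioc, mem_insert]; omega
      simp only [hf]
      rw [this, sum_insert (by simp), add_comm]
  -- Vertically adjacent values differ by the horizontal edge between them. This is trivial in the
  -- column `-N - 1`, where everything vanishes, and the cycle condition at a corner carries it from
  -- one column to the next.
  have f_vert_nat : ∀ (n : ℕ) b, f (-N - 1 + n) b + f (-N - 1 + n) (b - 1) +
      c (hEdge (-N - 1 + n) b) = 0 := fun n b => by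
    induction n with
    | zero =>
      simp only [Nat.cast_zero, add_zero]
      rw [f_left _ b le_rfl, f_left _ _ le_rfl, hh' _ b (by left; rw [lt_abs]; omega)]; simp
    | succ n ih =>
      have e : (-N - 1 + (n + 1 : ℕ) : ℤ) - 1 = -N - 1 + n := by push_cast; ring
      have h := hc (-N - 1 + (n + 1 : ℕ)) b
      rw [f_step _ b, f_step _ (b - 1), e]
      rw [e] at h
      linear_combination ih + h - two (c (hEdge (-N - 1 + n) b))
  have f_vert : ∀ a b, f a b + f a (b - 1) + c (hEdge a b) = 0 := fun a b => by
    rcases le_or_gt a (-N - 1) with h | h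
    · rw [f_left a b h, f_left a _ h, hh' a b (by left; rw [lt_abs]; omega)]; simp
    · have := f_vert_nat (a - (-N - 1)).toNat b
      rwa [show (-N - 1 + ((a - (-N - 1)).toNat : ℤ)) = a by omega] at this
  have f_row : ∀ a b, N < |b| → f a b = 0 := fun a b h =>
    sum_eq_zero fun x _ => hv' x b (Or.inr h)
  -- To the right of the support there are no horizontal edges, so `f` is constant along a column,
  -- and it vanishes in the row `-N - 1`.
  have f_right_nat : ∀ a, N < a → ∀ n : ℕ, f a (-N - 1 + n) = 0 := fun a h n => by
    induction n with
    | zero => exact f_row _ _ (by rw [lt_abs]; right; push_cast; omega)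
    | succ n ih =>
      have h' := f_vert a (-N - 1 + (n + 1 : ℕ))
      rw [hh' a _ (by left; rw [lt_abs]; omega),
        show (-N - 1 + (n + 1 : ℕ) : ℤ) - 1 = -N - 1 + n by push_cast; ring, ih] at h'
      simpa using h'
  have f_right : ∀ a b, N < a → f a b = 0 := fun a b h => by
    rcases le_or_gt b (-N - 1) with hb | hb
    · exact f_row a b (by rw [lt_abs]; omega)
    · have := f_right_nat a h (b - (-N - 1)).toNat
      rwa [show (-N - 1 + ((b - (-N - 1)).toNat : ℤ)) = b by omega] at this
  have parity : ∀ x y z : ZMod 2, x + y + z = 0 → (¬ (x ≠ 0 ↔ y ≠ 0) ↔ z ≠ 0) := by decide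
  refine ⟨{k | f k.1 k.2 ≠ 0}, ?_, ?_⟩
  · refine ((Set.finite_Icc (-N) N).prod (Set.finite_Icc (-N) N)).subset ?_
    rintro ⟨a, b⟩ h
    have h' : f a b ≠ 0 := h
    have h1 := mt (f_left a b) h'
    have h2 := mt (f_right a b) h'
    have h3 := mt (f_row a b) h'
    rw [lt_abs] at h3
    simp only [Set.mem_prod, Set.mem_Icc]
    omega
  · intro e he
    rcases he.cases with ⟨a, b, rfl⟩ | ⟨a, b, rfl⟩
    · rw [hEdge_mem_edgeBoundary]
      exact parity _ _ _ (f_vert a b)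
    · rw [vEdge_mem_edgeBoundary]
      refine parity _ _ _ ?_
      change f a b + f (a - 1) b + _ = 0
      rw [f_step a b]
      linear_combination two (f (a - 1) b) + two (c (vEdge a b))

/-- The mod 2 boundary of a walk in the lattice consists of its two ends. -/
lemma count_edges_corner {G : SimpleGraph Corner} {u w : Corner} (p : G.Walk u w)
    (hp : ∀ e ∈ p.edges, IsLatticeEdge e) (a b : ℤ) :
    ((p.edges.count (hEdge a b) : ℕ) + (p.edges.count (hEdge (a - 1) b) : ℕ) +
      (p.edges.count (vEdge a b) : ℕ) + (p.edges.count (vEdge a (b - 1)) : ℕ) : ZMod 2) =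
      (if (a, b) = u then 1 else 0) + if (a, b) = w then 1 else 0 := by
  induction p with
  | nil => simp [CharTwo.add_self_eq_zero]
  | @cons u v w h p ih =>
    have ih := ih fun e he => hp e (by simp [he])
    -- The first edge of the walk contributes its two ends; the end `v` then cancels mod 2 against
    -- the start of the remaining walk.
    have key : (((if s(u, v) = hEdge a b then 1 else 0) +
        (if s(u, v) = hEdge (a - 1) b then 1 else 0) + (if s(u, v) = vEdge a b then 1 else 0) +
        if s(u, v) = vEdge a (b - 1) then 1 else 0 : ZMod 2)) =
        (if (a, b) = u then 1 else 0) + if (a, b) = v then 1 else 0 := by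
      rcases (hp s(u, v) (by simp)).cases with ⟨x, y, e⟩ | ⟨x, y, e⟩
      · have : (if (a, b) = u then (1 : ZMod 2) else 0) + (if (a, b) = v then 1 else 0) =
            (if (a, b) = (x, y) then 1 else 0) + if (a, b) = (x + 1, y) then 1 else 0 := by
          rcases Sym2.eq_iff.1 e with ⟨rfl, rfl⟩ | ⟨rfl, rfl⟩
          · rfl
          · rw [add_comm]
        rw [this, e]
        simp only [hEdge_inj, hEdge_ne_vEdge, Prod.mk.injEq, if_false, add_zero]
        congr 1 <;> refine if_congr ?_ rfl rfl <;> omega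
      · have : (if (a, b) = u then (1 : ZMod 2) else 0) + (if (a, b) = v then 1 else 0) =
            (if (a, b) = (x, y) then 1 else 0) + if (a, b) = (x, y + 1) then 1 else 0 := by
          rcases Sym2.eq_iff.1 e with ⟨rfl, rfl⟩ | ⟨rfl, rfl⟩
          · rfl
          · rw [add_comm]
        rw [this, e]
        simp only [vEdge_inj, vEdge_ne_hEdge, Prod.mk.injEq, if_false, zero_add]
        congr 1 <;> refine if_congr ?_ rfl rfl <;> omega
    simp only [SimpleGraph.Walk.edges_cons, List.count_cons, Nat.cast_add, beq_iff_eq,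
      Nat.cast_ite, Nat.cast_one, Nat.cast_zero]
    linear_combination ih + key + CharTwo.add_self_eq_zero (if (a, b) = v then (1 : ZMod 2) else 0)

/-- A closed lattice walk bounds, mod 2, a finite set of squares. -/
lemma exists_finite_edgeBoundary_walk {G : SimpleGraph Corner} {u : Corner} (p : G.Walk u u)
    (hp : ∀ e ∈ p.edges, IsLatticeEdge e) :
    ∃ B : Set Square, B.Finite ∧
      ∀ e, IsLatticeEdge e → (e ∈ edgeBoundary B ↔ Odd (p.edges.count e)) := by
  obtain ⟨N, hN⟩ : ∃ N : ℤ, ∀ x ∈ p.support, |x.1| ≤ N ∧ |x.2| ≤ N := by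
    obtain ⟨N, hN⟩ := (p.support.toFinset.image fun x => max |x.1| |x.2|).bddAbove
    refine ⟨N, fun x hx => ?_⟩
    have := hN (Finset.mem_coe.2 (Finset.mem_image_of_mem (fun x : Corner => max |x.1| |x.2|)
      (List.mem_toFinset.2 hx)))
    exact max_le_iff.1 this
  have hmem : ∀ e, ((p.edges.count e : ℕ) : ZMod 2) ≠ 0 → e ∈ p.edges := fun e he => by
    by_contra h
    rw [List.count_eq_zero_of_not_mem h] at he
    simp at he
  obtain ⟨B, hB, h⟩ := exists_finite_edgeBoundary_eq
    (c := fun e => ((p.edges.count e : ℕ) : ZMod 2)) (N := N)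
    (fun a b h => hN _ (p.fst_mem_support_of_mem_edges (hmem _ h)))
    (fun a b h => hN _ (p.fst_mem_support_of_mem_edges (hmem _ h)))
    (fun a b => by
      rw [count_edges_corner p hp]
      exact CharTwo.add_self_eq_zero _)
  exact ⟨B, hB, fun e he => by rw [h e he, ZMod.natCast_ne_zero_iff_odd]⟩

/-! ### The component of the origin and its graph -/

variable {occ : Set Square}

lemma not_isDiag_of_mem_squareEdges {e : Sym2 Corner} {k : Square} (h : e ∈ squareEdges k) :
    ¬ e.IsDiag := by
  rcases IsLatticeEdge.cases ⟨k, h⟩ with ⟨a, b, rfl⟩ | ⟨a, b, rfl⟩ <;> simp [hEdge, vEdge]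

lemma mem_edgeSet_compGraph {e : Sym2 Corner} :
    e ∈ (compGraph occ).edgeSet ↔ ∃ k ∈ component occ, e ∈ squareEdges k := by
  rw [compGraph, SimpleGraph.edgeSet_fromEdgeSet]
  constructor
  · exact fun h => h.1
  · rintro ⟨k, hk, hk'⟩
    exact ⟨⟨k, hk, hk'⟩, not_isDiag_of_mem_squareEdges hk'⟩

lemma isLatticeEdge_of_mem_edgeSet {e : Sym2 Corner} (h : e ∈ (compGraph occ).edgeSet) :
    IsLatticeEdge e := by
  obtain ⟨k, -, hk⟩ := mem_edgeSet_compGraph.1 h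
  exact ⟨k, hk⟩

lemma occ_of_mem_component {k : Square} (h : k ∈ component occ) : k ∈ occ := by
  obtain ⟨h0, h⟩ := h
  rcases Relation.ReflTransGen.cases_tail h with rfl | ⟨c, -, h⟩
  · exact h0
  · exact h.2.1

lemma mem_corners_of_mem_squareEdges {e : Sym2 Corner} {k : Square} (h : e ∈ squareEdges k)
    {v : Corner} (hv : v ∈ e) : v ∈ corners k := by
  rcases h with rfl | rfl | rfl | rfl <;> simp only [Sym2.mem_iff] at hv <;>
    rcases hv with rfl | rfl <;> simp [corners]

/-- The endpoints of a common edge are common corners, so distinct squares with a common edge are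
star-adjacent. -/
lemma mem_component_of_mem_squareEdges {e : Sym2 Corner} {k l : Square} (hk : k ∈ component occ)
    (hl : l ∈ occ) (hke : e ∈ squareEdges k) (hle : e ∈ squareEdges l) : l ∈ component occ := by
  rcases eq_or_ne k l with rfl | hkl
  · exact hk
  · refine ⟨hk.1, hk.2.tail ⟨occ_of_mem_component hk, hl, hkl, ?_⟩⟩
    induction e with
    | h u v => exact ⟨u, mem_corners_of_mem_squareEdges hke (by simp),
        mem_corners_of_mem_squareEdges hle (by simp)⟩

/-! ### Outer squares, outer edges and cells -/

/-- The squares from which one can walk to infinity without crossing an edge of `G_C`. -/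
def outer (occ : Set Square) : Set Square :=
  {l | (region (compGraph occ).edgeSet l).Infinite}

/-- The edges between the outer squares and the others. -/
def outerEdges (occ : Set Square) : Set (Sym2 Corner) := edgeBoundary (outer occ)ᶜ

/-- The set of squares that can be reached without crossing an outer edge. -/
def cell (occ : Set Square) (k : Square) : Set Square := region (outerEdges occ) k

/-- All four edges of a square of the component belong to G_C, so its region is the square alone. -/
lemma not_mem_outer_of_mem_component {k : Square} (hk : k ∈ component occ) : k ∉ outer occ := by
  have : region (compGraph occ).edgeSet k ⊆ {k} := by
    intro l hl
    rcases Relation.ReflTransGen.cases_head hl with rfl | ⟨m, ⟨e, he, hke, -⟩, -⟩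
    · rfl
    · exact absurd (mem_edgeSet_compGraph.2 ⟨k, hk, hke⟩) he
  exact fun h => h ((Set.finite_singleton k).subset this)

/-- If no square of the component bordered `e`, then `e` would not be an edge of G_C, and crossing
it would put its two squares into one region; they would be both outer or both not. -/
lemma exists_of_mem_outerEdges {e : Sym2 Corner} (he : e ∈ outerEdges occ) :
    (∃ k ∈ component occ, e ∈ squareEdges k) ∧ ∃ l ∈ outer occ, e ∈ squareEdges l := by
  obtain ⟨⟨k, hk, hke⟩, l, hl, hle⟩ := he
  rw [Set.notMem_compl_iff] at hl
  refine ⟨?_, l, hl, hle⟩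
  by_contra h
  rw [← mem_edgeSet_compGraph] at h
  refine hk ?_
  have : Reach (compGraph occ).edgeSet l k := Relation.ReflTransGen.single ⟨e, h, hle, hke⟩
  rw [outer, Set.mem_ofPred_eq] at hl ⊢
  rwa [← region_eq this]

lemma outerEdges_subset : outerEdges occ ⊆ (compGraph occ).edgeSet :=
  fun _ he => mem_edgeSet_compGraph.2 (exists_of_mem_outerEdges he).1

/-- An outer edge borders only one square that is not outer. -/
lemma eq_of_mem_outerEdges {e : Sym2 Corner} (he : e ∈ outerEdges occ) {k k' : Square}
    (hk : k ∉ outer occ) (hk' : k' ∉ outer occ) (hke : e ∈ squareEdges k)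
    (hke' : e ∈ squareEdges k') : k = k' := by
  obtain ⟨-, l, hl, hle⟩ := exists_of_mem_outerEdges he
  rcases eq_or_eq_of_mem_squareEdges hke hle hke' (fun h => hk (h ▸ hl)) with rfl | rfl
  · rfl
  · exact absurd hl hk'

lemma not_occ_of_mem_outer {e : Sym2 Corner} {k l : Square} (hk : k ∈ component occ)
    (hl : l ∈ outer occ) (hke : e ∈ squareEdges k) (hle : e ∈ squareEdges l) : l ∉ occ :=
  fun h => not_mem_outer_of_mem_component (mem_component_of_mem_squareEdges hk h hke hle) hl

/-- A square is outer if a ray of squares that starts there avoids the component. -/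
lemma mem_outer_of_ray {k d : Square} (hd : d ≠ 0)
    (hadj : ∀ l, ∃ e, e ∈ squareEdges l ∧ e ∈ squareEdges (l + d))
    (hk : ∀ n : ℕ, k + n • d ∉ component occ) : k ∈ outer occ := by
  have hreach : ∀ n : ℕ, k + n • d ∈ region (compGraph occ).edgeSet k := fun n => by
    induction n with
    | zero => simpa using mem_region_self _ k
    | succ n ih =>
      obtain ⟨e, he, he'⟩ := hadj (k + n • d)
      have hs : k + (n + 1) • d = k + n • d + d := by rw [succ_nsmul, add_assoc]
      refine Relation.ReflTransGen.tail ih ⟨e, fun h => ?_, he, hs ▸ he'⟩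
      obtain ⟨m, hm, hme⟩ := mem_edgeSet_compGraph.1 h
      rcases eq_or_eq_of_mem_squareEdges he he' hme (by simpa using hd) with rfl | rfl
      · exact hk n hm
      · exact hk (n + 1) (hs ▸ hm)
  refine Set.infinite_of_injective_forall_mem (f := fun n : ℕ => k + n • d) ?_ hreach
  intro m n h
  have h : m • d = n • d := add_left_cancel h
  by_contra hmn
  refine hd (Prod.ext ?_ ?_)
  · have : m • d.1 = n • d.1 := congrArg Prod.fst h
    simp only [nsmul_eq_mul] at this
    by_contra h0
    exact hmn (by exact_mod_cast mul_right_cancel₀ h0 this)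
  · have : m • d.2 = n • d.2 := congrArg Prod.snd h
    simp only [nsmul_eq_mul] at this
    by_contra h0
    exact hmn (by exact_mod_cast mul_right_cancel₀ h0 this)

/-- From any square outside a box around the component, one of the four axis directions leads
straight away from the box. -/
lemma finite_compl_outer (hfin : (component occ).Finite) : (outer occ)ᶜ.Finite := by
  obtain ⟨N, hN⟩ : ∃ N : ℤ, ∀ x ∈ component occ, |x.1| ≤ N ∧ |x.2| ≤ N := by
    obtain ⟨N, hN⟩ := (hfin.image fun x => max |x.1| |x.2|).bddAbove
    exact ⟨N, fun x hx => max_le_iff.1 (hN (Set.mem_image_of_mem _ hx))⟩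
  have hN' : ∀ x ∈ component occ, -N ≤ x.1 ∧ x.1 ≤ N ∧ -N ≤ x.2 ∧ x.2 ≤ N := fun x hx => by
    have := hN x hx
    rw [abs_le, abs_le] at this
    tauto
  refine ((Set.finite_Icc (-N) N).prod (Set.finite_Icc (-N) N)).subset ?_
  intro k hk
  by_contra h
  rw [Set.mem_prod, Set.mem_Icc, Set.mem_Icc] at h
  refine hk ?_
  have hcase : k.1 > N ∨ k.1 < -N ∨ k.2 > N ∨ k.2 < -N := by omega
  rcases hcase with h | h | h | h
  · refine mem_outer_of_ray (d := (1, 0)) (by simp)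
      (fun l => ⟨vEdge (l.1 + 1) l.2, by simp, by simp [Prod.ext_iff]⟩) fun n hn => ?_
    have := hN' _ hn
    simp at this
    omega
  · refine mem_outer_of_ray (d := (-1, 0)) (by simp)
      (fun l => ⟨vEdge l.1 l.2, by simp, by simp [Prod.ext_iff]; omega⟩) fun n hn => ?_
    have := hN' _ hn
    simp at this
    omega
  · refine mem_outer_of_ray (d := (0, 1)) (by simp)
      (fun l => ⟨hEdge l.1 (l.2 + 1), by simp, by simp [Prod.ext_iff]⟩) fun n hn => ?_
    have := hN' _ hn
    simp at this
    omega
  · refine mem_outer_of_ray (d := (0, -1)) (by simp)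
      (fun l => ⟨hEdge l.1 l.2, by simp, by simp [Prod.ext_iff]; omega⟩) fun n hn => ?_
    have := hN' _ hn
    simp at this
    omega

lemma mem_outer_iff_of_reach {k l : Square} (h : Reach (outerEdges occ) k l) :
    k ∈ outer occ ↔ l ∈ outer occ :=
  not_iff_not.1 (h.mem_iff (B := (outer occ)ᶜ) subset_rfl)

lemma cell_subset {k : Square} (hk : k ∉ outer occ) : cell occ k ⊆ (outer occ)ᶜ :=
  fun _ hl => (not_congr (mem_outer_iff_of_reach hl)).1 hk

lemma cell_finite (hfin : (component occ).Finite) {k : Square} (hk : k ∉ outer occ) :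
    (cell occ k).Finite :=
  (finite_compl_outer hfin).subset (cell_subset hk)

lemma edgeBoundary_cell_subset (k : Square) : edgeBoundary (cell occ k) ⊆ outerEdges occ :=
  edgeBoundary_region_subset _ k

/-- The square of the component at a boundary edge of a cell lies in the cell. -/
lemma exists_of_mem_edgeBoundary_cell {k : Square} (hk : k ∉ outer occ) {e : Sym2 Corner}
    (he : e ∈ edgeBoundary (cell occ k)) :
    (∃ m ∈ component occ, m ∈ cell occ k ∧ e ∈ squareEdges m) ∧
      ∃ l ∈ outer occ, e ∈ squareEdges l := by
  have heD := edgeBoundary_cell_subset k he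
  obtain ⟨⟨m, hm, hme⟩, hl⟩ := exists_of_mem_outerEdges heD
  obtain ⟨⟨m', hm', hme'⟩, -⟩ := he
  obtain rfl := eq_of_mem_outerEdges heD (not_mem_outer_of_mem_component hm)
    (cell_subset hk hm') hme hme'
  exact ⟨⟨m, hm, hm', hme⟩, hl⟩

lemma mem_edgeBoundary_cell {k m : Square} (hk : k ∉ outer occ) {e : Sym2 Corner}
    (he : e ∈ outerEdges occ) (hm : m ∈ cell occ k) (hme : e ∈ squareEdges m) :
    e ∈ edgeBoundary (cell occ k) := by
  obtain ⟨-, l, hl, hle⟩ := exists_of_mem_outerEdges he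
  exact ⟨⟨m, hm, hme⟩, l, fun h => cell_subset hk h hl, hle⟩

/-- The only non-outer square at the common edge lies in both cells. -/
lemma cell_eq_of_mem_edgeBoundary {k k' : Square} (hk : k ∉ outer occ) (hk' : k' ∉ outer occ)
    {e : Sym2 Corner} (he : e ∈ edgeBoundary (cell occ k)) (he' : e ∈ edgeBoundary (cell occ k')) :
    cell occ k = cell occ k' := by
  have heD := edgeBoundary_cell_subset k he
  obtain ⟨⟨m, hm, hmk, hme⟩, -⟩ := exists_of_mem_edgeBoundary_cell hk he
  obtain ⟨⟨m', hm', hmk', hme'⟩, -⟩ := exists_of_mem_edgeBoundary_cell hk' he'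
  obtain rfl := eq_of_mem_outerEdges heD (not_mem_outer_of_mem_component hm)
    (not_mem_outer_of_mem_component hm') hme hme'
  exact (region_eq hmk).trans (region_eq hmk').symm

/-- A closed walk along outer edges traverses all boundary edges of a cell with the same
parity. -/
lemma odd_count_iff_of_mem_edgeBoundary_cell {G : SimpleGraph Corner} {u : Corner} (p : G.Walk u u)
    (hp : ∀ e ∈ p.edges, e ∈ outerEdges occ) {k : Square} (hk : k ∉ outer occ) {e e' : Sym2 Corner}
    (he : e ∈ edgeBoundary (cell occ k)) (he' : e' ∈ edgeBoundary (cell occ k)) :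
    Odd (p.edges.count e) ↔ Odd (p.edges.count e') := by
  obtain ⟨B, hB, h⟩ := exists_finite_edgeBoundary_walk p
    fun e he => isLatticeEdge_of_mem_edgeBoundary (hp e he)
  have hBD : edgeBoundary B ⊆ outerEdges occ := fun e he =>
    hp e (List.count_pos_iff.1 ((h e (isLatticeEdge_of_mem_edgeBoundary he)).1 he).pos)
  -- The infinite region of an outer square is not cut by the boundary of `B`, so it cannot meet the
  -- finite set `B`.
  have hBout : ∀ l ∈ outer occ, l ∉ B := fun l hl hlB =>
    hl (hB.subset fun m hm => ((hm.mono outerEdges_subset).mem_iff hBD).1 hlB)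
  -- Of the two squares at `e`, the outer one is not in `B`, and the inner one is in `B` exactly
  -- when `k` is, since they share a cell.
  have key : ∀ e ∈ edgeBoundary (cell occ k), (Odd (p.edges.count e) ↔ k ∈ B) := fun e he => by
    obtain ⟨⟨m, hm, hmk, hme⟩, l, hl, hle⟩ := exists_of_mem_edgeBoundary_cell hk he
    rw [← h e ⟨m, hme⟩, mem_edgeBoundary_iff hme hle
      (fun h => not_mem_outer_of_mem_component hm (h ▸ hl)), Reach.mem_iff hBD hmk]
    have := hBout l hl
    tauto
  rw [key e he, key e' he']

/-! ### Cycles in graphs and as subgraphs -/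

section Graph

variable {V : Type*} {G : SimpleGraph V}

/-- A finite graph with an edge in which no vertex has degree one contains a cycle. -/
lemma exists_isCycle_of_finite_edgeSet (hfin : G.edgeSet.Finite) (hne : ∃ u v, G.Adj u v)
    (h : ∀ u v, G.Adj u v → ∃ w, w ≠ u ∧ G.Adj v w) :
    ∃ (v : V) (p : G.Walk v v), p.IsCycle := by
  classical
  by_contra hac
  have hac : G.IsAcyclic := fun v p hp => hac ⟨v, p, hp⟩
  -- In an acyclic graph the end of a path is adjacent to no vertex of the path but the penultimate
  -- one, so a further neighbour always extends the path. Paths of every length contradict the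
  -- finiteness of the edge set.
  have long : ∀ n : ℕ, ∃ (u v : V) (p : G.Walk u v), p.IsPath ∧ p.length = n + 1 := fun n => by
    induction n with
    | zero =>
      obtain ⟨u, v, huv⟩ := hne
      exact ⟨u, v, .cons huv .nil, by simp [huv.ne], by simp⟩
    | succ n ih =>
      obtain ⟨u, v, p, hp, hl⟩ := ih
      have hnil : ¬ p.Nil := fun h => by
        rw [← SimpleGraph.Walk.length_eq_zero_iff] at h
        omega
      obtain ⟨w, hw, hvw⟩ := h _ _ (p.adj_penultimate hnil)
      have hws : w ∉ p.support := fun hs => hw (hac.eq_penultimate_of_adj_end hp hvw hs)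
      exact ⟨u, w, p.concat hvw, hp.concat hws hvw, by simp [hl]⟩
  obtain ⟨u, v, p, hp, hl⟩ := long hfin.toFinset.card
  have hcard : p.edges.toFinset ⊆ hfin.toFinset := fun e he => by
    rw [List.mem_toFinset] at he
    simpa using p.edges_subset_edgeSet he
  have := Finset.card_le_card hcard
  rw [List.toFinset_card_of_nodup hp.isTrail.edges_nodup, SimpleGraph.Walk.length_edges, hl] at this
  omega

/-- If the edges of a cycle belong to a second cycle, the cycles have the same edges. -/
lemma mem_edges_of_cycle_subset [DecidableEq V] {u v : V} {p : G.Walk u u} {q : G.Walk v v}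
    (hp : p.IsCycle) (hq : q.IsCycle) (h : ∀ e ∈ p.edges, e ∈ q.edges) :
    ∀ e ∈ q.edges, e ∈ p.edges := by
  have hu : u ∈ q.support := by
    obtain ⟨e, he, hue⟩ := (SimpleGraph.Walk.mem_support_iff_exists_mem_edges_of_not_nil
      hp.not_nil).1 p.start_mem_support
    exact (SimpleGraph.Walk.mem_support_iff_exists_mem_edges_of_not_nil hq.not_nil).2 ⟨e, h e he, hue⟩
  -- At a common vertex both cycles have degree two, so they have the same edges there; walking
  -- along `q` spreads this to all of `q`.
  have hadj : ∀ x y, x ∈ p.support → s(x, y) ∈ q.edges → s(x, y) ∈ p.edges := by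
    intro x y hx hxy
    have hxq : x ∈ q.support := q.fst_mem_support_of_mem_edges hxy
    have hsub : p.toSubgraph.neighborSet x ⊆ q.toSubgraph.neighborSet x := fun z hz => by
      rw [SimpleGraph.Subgraph.mem_neighborSet, SimpleGraph.Walk.adj_toSubgraph_iff_mem_edges] at *
      exact h _ hz
    have hn := hq.ncard_neighborSet_toSubgraph_eq_two hxq
    have heq := Set.eq_of_subset_of_ncard_le hsub
      (by rw [hn, hp.ncard_neighborSet_toSubgraph_eq_two hx])
      (Set.finite_of_ncard_ne_zero (by rw [hn]; omega))
    have hy : y ∈ q.toSubgraph.neighborSet x := by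
      rwa [SimpleGraph.Subgraph.mem_neighborSet, SimpleGraph.Walk.adj_toSubgraph_iff_mem_edges]
    rw [← heq] at hy
    rwa [SimpleGraph.Subgraph.mem_neighborSet, SimpleGraph.Walk.adj_toSubgraph_iff_mem_edges] at hy
  have walk : ∀ {x y : V} (r : G.Walk x y), x ∈ p.support → (∀ e ∈ r.edges, e ∈ q.edges) →
      ∀ e ∈ r.edges, e ∈ p.edges := by
    intro x y r
    induction r with
    | nil => simp
    | @cons x y z hxy r ih =>
      intro hx hr e he
      have h1 := hadj x y hx (hr _ (by simp))
      rw [SimpleGraph.Walk.edges_cons, List.mem_cons] at he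
      rcases he with rfl | he
      · exact h1
      · exact ih (p.snd_mem_support_of_mem_edges h1) (fun e he => hr e (by simp [he])) e he
  intro e he
  refine walk (q.rotate u hu) p.start_mem_support ?_ e ?_
  · exact fun e he => (q.rotate_edges u hu).mem_iff.1 he
  · exact (q.rotate_edges u hu).mem_iff.2 he

lemma mem_verts_iff_of_isCycle {v : V} {p : G.Walk v v} (hp : p.IsCycle) {x : V} :
    x ∈ p.toSubgraph.verts ↔ ∃ e ∈ p.toSubgraph.edgeSet, x ∈ e := by
  rw [SimpleGraph.Walk.mem_verts_toSubgraph,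
    SimpleGraph.Walk.mem_support_iff_exists_mem_edges_of_not_nil hp.not_nil]
  simp

lemma subgraph_eq_of_edgeSet_eq {H H' : G.Subgraph}
    (hH : ∀ x, x ∈ H.verts ↔ ∃ e ∈ H.edgeSet, x ∈ e)
    (hH' : ∀ x, x ∈ H'.verts ↔ ∃ e ∈ H'.edgeSet, x ∈ e) (h : H.edgeSet = H'.edgeSet) : H = H' := by
  refine SimpleGraph.Subgraph.ext ?_ ?_
  · ext x
    rw [hH, hH', h]
  · ext x y
    rw [← SimpleGraph.Subgraph.mem_edgeSet, ← SimpleGraph.Subgraph.mem_edgeSet, h]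

end Graph

lemma IsCycle.mem_verts_iff {G : SimpleGraph Corner} {H : G.Subgraph} (hH : IsCycle H)
    (x : Corner) : x ∈ H.verts ↔ ∃ e ∈ H.edgeSet, x ∈ e := by
  obtain ⟨v, p, hp, rfl⟩ := hH
  exact mem_verts_iff_of_isCycle hp

lemma IsCycle.eq_of_edgeSet_eq {G : SimpleGraph Corner} {H H' : G.Subgraph} (hH : IsCycle H)
    (hH' : IsCycle H') (h : H.edgeSet = H'.edgeSet) : H = H' :=
  subgraph_eq_of_edgeSet_eq hH.mem_verts_iff hH'.mem_verts_iff h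

lemma IsCycle.eq_of_edgeSet_subset {G : SimpleGraph Corner} {H H' : G.Subgraph} (hH : IsCycle H)
    (hH' : IsCycle H') (h : H.edgeSet ⊆ H'.edgeSet) : H = H' := by
  refine hH.eq_of_edgeSet_eq hH' (h.antisymm ?_)
  obtain ⟨v, p, hp, rfl⟩ := hH
  obtain ⟨w, q, hq, rfl⟩ := hH'
  intro e he
  rw [SimpleGraph.Walk.mem_edges_toSubgraph] at *
  exact mem_edges_of_cycle_subset hp hq
    (fun e he => (q.mem_edges_toSubgraph).1 (h (p.mem_edges_toSubgraph.2 he))) e he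

lemma IsCycle.edgeSet_nonempty {G : SimpleGraph Corner} {H : G.Subgraph} (hH : IsCycle H) :
    H.edgeSet.Nonempty := by
  have hv : ∃ x, x ∈ H.verts := by
    obtain ⟨v, p, hp, rfl⟩ := hH
    exact ⟨v, p.start_mem_verts_toSubgraph⟩
  obtain ⟨x, hx⟩ := hv
  obtain ⟨e, he, -⟩ := (hH.mem_verts_iff x).1 hx
  exact ⟨e, he⟩

/-! ### Boundaries of cells are cycles -/

lemma not_isDiag_of_mem_edgeBoundary {A : Set Square} {e : Sym2 Corner} (he : e ∈ edgeBoundary A) :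
    ¬ e.IsDiag := by
  obtain ⟨⟨k, -, hk⟩, -⟩ := he
  exact not_isDiag_of_mem_squareEdges hk

/-- No corner is on exactly one boundary edge of a set of squares. -/
lemma exists_ne_mem_edgeBoundary {A : Set Square} {u v : Corner} (h : s(u, v) ∈ edgeBoundary A) :
    ∃ w, w ≠ u ∧ s(v, w) ∈ edgeBoundary A := by
  obtain ⟨a, b⟩ := v
  have e1 : s((a, b), (a + 1, b)) = hEdge a b := rfl
  have e2 : s((a, b), (a - 1, b)) = hEdge (a - 1) b := by simp [hEdge, Sym2.eq_swap]
  have e3 : s((a, b), (a, b + 1)) = vEdge a b := rfl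
  have e4 : s((a, b), (a, b - 1)) = vEdge a (b - 1) := by simp [vEdge, Sym2.eq_swap]
  have hu : u = (a + 1, b) ∨ u = (a - 1, b) ∨ u = (a, b + 1) ∨ u = (a, b - 1) := by
    obtain ⟨x, y⟩ := u
    rcases (isLatticeEdge_of_mem_edgeBoundary h).cases with ⟨c, d, he⟩ | ⟨c, d, he⟩ <;>
    · simp only [hEdge, vEdge, Sym2.eq_iff, Prod.mk.injEq] at he ⊢
      omega
  -- The boundary edges at a corner are the changes of membership in `A` met on a round through its
  -- four squares; there cannot be exactly one change.
  by_contra! hcon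
  have h1 := hcon (a + 1, b)
  have h2 := hcon (a - 1, b)
  have h3 := hcon (a, b + 1)
  have h4 := hcon (a, b - 1)
  rw [e1, hEdge_mem_edgeBoundary] at h1
  rw [e2, hEdge_mem_edgeBoundary] at h2
  rw [e3, vEdge_mem_edgeBoundary] at h3
  rw [e4, vEdge_mem_edgeBoundary] at h4
  rw [Sym2.eq_swap] at h
  rcases hu with rfl | rfl | rfl | rfl
  · rw [e1, hEdge_mem_edgeBoundary] at h
    have h2 := h2 (by simp; omega)
    have h3 := h3 (by simp)
    have h4 := h4 (by simp)
    grind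
  · rw [e2, hEdge_mem_edgeBoundary] at h
    have h1 := h1 (by simp; omega)
    have h3 := h3 (by simp)
    have h4 := h4 (by simp)
    grind
  · rw [e3, vEdge_mem_edgeBoundary] at h
    have h2 := h2 (by simp)
    have h1 := h1 (by simp)
    have h4 := h4 (by simp; omega)
    grind
  · rw [e4, vEdge_mem_edgeBoundary] at h
    have h2 := h2 (by simp)
    have h1 := h1 (by simp)
    have h3 := h3 (by simp; omega)
    grind

/-- The boundary of a cell is a cycle. -/
lemma exists_isCycle_edgeSet_eq (hfin : (component occ).Finite) {k : Square} (hk : k ∉ outer occ) :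
    ∃ H : (compGraph occ).Subgraph, IsCycle H ∧ H.edgeSet = edgeBoundary (cell occ k) := by
  set Γ : SimpleGraph Corner := SimpleGraph.fromEdgeSet (edgeBoundary (cell occ k)) with hΓ
  have hΓe : Γ.edgeSet = edgeBoundary (cell occ k) := by
    rw [hΓ, SimpleGraph.edgeSet_fromEdgeSet]
    exact Set.ext fun e => ⟨fun h => h.1, fun h => ⟨h, not_isDiag_of_mem_edgeBoundary h⟩⟩
  have hadj : ∀ u v, Γ.Adj u v ↔ s(u, v) ∈ edgeBoundary (cell occ k) := fun u v => by
    rw [← hΓe, SimpleGraph.mem_edgeSet]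
  have hle : Γ ≤ compGraph occ := by
    rw [← SimpleGraph.edgeSet_subset_edgeSet, hΓe]
    exact (edgeBoundary_cell_subset k).trans outerEdges_subset
  obtain ⟨v, p, hp⟩ := exists_isCycle_of_finite_edgeSet (G := Γ)
    (by rw [hΓe]; exact edgeBoundary_finite (cell_finite hfin hk))
    (by
      obtain ⟨e, he⟩ := edgeBoundary_nonempty (cell_finite hfin hk) ⟨k, mem_region_self _ k⟩
      induction e with
      | h u v => exact ⟨u, v, (hadj u v).2 he⟩)
    (fun u v huv => by
      obtain ⟨w, hw, h⟩ := exists_ne_mem_edgeBoundary ((hadj u v).1 huv)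
      exact ⟨w, hw, (hadj v w).2 h⟩)
  have hpe : ∀ e ∈ p.edges, e ∈ edgeBoundary (cell occ k) := fun e he =>
    hΓe ▸ p.edges_subset_edgeSet he
  refine ⟨(p.mapLe hle).toSubgraph, ⟨v, p.mapLe hle, hp.mapLe hle, rfl⟩, ?_⟩
  ext e
  rw [SimpleGraph.Walk.mem_edges_toSubgraph, SimpleGraph.Walk.edges_mapLe_eq_edges]
  refine ⟨hpe e, fun he => ?_⟩
  -- The cycle traverses one boundary edge of the cell exactly once, so by parity it traverses every
  -- one.
  obtain ⟨e', he', -⟩ := (SimpleGraph.Walk.mem_support_iff_exists_mem_edges_of_not_nil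
      hp.not_nil).1 p.start_mem_support
  have h1 : Odd (p.edges.count e') := by
    rw [List.count_eq_one_of_mem hp.edges_nodup he']; exact odd_one
  rw [← odd_count_iff_of_mem_edgeBoundary_cell p (fun e he => edgeBoundary_cell_subset k (hpe e he))
    hk he (hpe e' he')] at h1
  exact List.count_pos_iff.1 h1.pos

/-- The cycles around different cells share at most one vertex. -/
lemma subsingleton_inter_verts {k k' : Square} (hk : k ∉ outer occ) (hk' : k' ∉ outer occ)
    {H H' : (compGraph occ).Subgraph} (hH : IsCycle H) (hH' : IsCycle H')
    (he : H.edgeSet = edgeBoundary (cell occ k)) (he' : H'.edgeSet = edgeBoundary (cell occ k'))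
    (hne : H ≠ H') : (H.verts ∩ H'.verts).Subsingleton := by
  have hdisj : ∀ e ∈ H.edgeSet, e ∉ H'.edgeSet := fun e h h' => by
    rw [he] at h
    rw [he'] at h'
    refine hne (hH.eq_of_edgeSet_eq hH' ?_)
    rw [he, he', cell_eq_of_mem_edgeBoundary hk hk' h h']
  rintro x ⟨hx, hx'⟩ y ⟨hy, hy'⟩
  by_contra hxy
  -- Two common vertices cut each cycle into two arcs.
  have rot : ∀ {K : (compGraph occ).Subgraph}, IsCycle K → x ∈ K.verts → y ∈ K.verts →
      ∃ (p : (compGraph occ).Walk x y) (q : (compGraph occ).Walk y x),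
        (p.append q).IsCycle ∧ ∀ e, e ∈ K.edgeSet ↔ e ∈ p.edges ∨ e ∈ q.edges := by
    rintro K ⟨v, p, hp, rfl⟩ hx hy
    rw [SimpleGraph.Walk.mem_verts_toSubgraph] at hx hy
    have hy' : y ∈ (p.rotate x hx).support := by
      rwa [← SimpleGraph.Walk.mem_verts_toSubgraph, SimpleGraph.Walk.toSubgraph_rotate,
        SimpleGraph.Walk.mem_verts_toSubgraph]
    refine ⟨(p.rotate x hx).takeUntil y hy', (p.rotate x hx).dropUntil y hy', ?_, fun e => ?_⟩
    · rw [SimpleGraph.Walk.take_spec]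
      exact hp.rotate hx
    · rw [← List.mem_append, ← SimpleGraph.Walk.edges_append, SimpleGraph.Walk.take_spec,
        SimpleGraph.Walk.mem_edges_toSubgraph]
      exact (p.rotate_edges x hx).mem_iff.symm
  obtain ⟨p, q, hpq, hm⟩ := rot hH hx hy
  obtain ⟨p', q', -, hm'⟩ := rot hH' hx' hy'
  have hnd := hpq.edges_nodup
  rw [SimpleGraph.Walk.edges_append, List.nodup_append'] at hnd
  obtain ⟨e₁, he₁, -⟩ := (SimpleGraph.Walk.mem_support_iff_exists_mem_edges_of_not_nil
    (SimpleGraph.Walk.not_nil_of_ne hxy)).1 p.start_mem_support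
  obtain ⟨e₂, he₂, -⟩ := (SimpleGraph.Walk.mem_support_iff_exists_mem_edges_of_not_nil
    (SimpleGraph.Walk.not_nil_of_ne (Ne.symm hxy))).1 q.start_mem_support
  have hH₁ : e₁ ∈ H.edgeSet := (hm e₁).2 (Or.inl he₁)
  have hH₂ : e₂ ∈ H.edgeSet := (hm e₂).2 (Or.inr he₂)
  have hp' : ∀ e ∈ p'.edges, e ∈ H'.edgeSet := fun e h => (hm' e).2 (Or.inl h)
  -- Close the arc `p` of `H` by an arc of `H'`. This walk traverses `e₁` once and `e₂` never,
  -- although both are boundary edges of the cell of `k`.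
  have key := odd_count_iff_of_mem_edgeBoundary_cell (p.append p'.reverse) (fun e h => by
      rw [SimpleGraph.Walk.edges_append, List.mem_append, SimpleGraph.Walk.edges_reverse,
        List.mem_reverse] at h
      rcases h with h | h
      · exact edgeBoundary_cell_subset k (he ▸ (hm e).2 (Or.inl h))
      · exact edgeBoundary_cell_subset k' (he' ▸ hp' e h)) hk (he ▸ hH₁) (he ▸ hH₂)
  rw [SimpleGraph.Walk.edges_append, SimpleGraph.Walk.edges_reverse, List.count_append,
    List.count_append, List.count_reverse, List.count_reverse,
    List.count_eq_zero_of_not_mem (fun h => hdisj _ hH₁ (hp' _ h)),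
    List.count_eq_zero_of_not_mem (fun h => hdisj _ hH₂ (hp' _ h)),
    List.count_eq_zero_of_not_mem (fun h => hnd.2.2 h he₂),
    List.count_eq_one_of_mem hnd.1 he₁] at key
  simp at key

/-! ### Splicing touching cycles into a circuit -/

/-- A finite family of edge-disjoint cycles that is connected under sharing vertices is traversed
by a circuit. -/
lemma exists_isCircuit_of_touching {G : SimpleGraph Corner} {𝒞 : Set G.Subgraph} (hfin : 𝒞.Finite)
    (hcyc : ∀ H ∈ 𝒞, IsCycle H)
    (hdisj : ∀ H ∈ 𝒞, ∀ H' ∈ 𝒞, H ≠ H' → ∀ e ∈ H.edgeSet, e ∉ H'.edgeSet) {H₀ : G.Subgraph}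
    (h₀ : H₀ ∈ 𝒞)
    (hconn : ∀ H ∈ 𝒞, Relation.ReflTransGen
      (fun K K' => K' ∈ 𝒞 ∧ (K.verts ∩ K'.verts).Nonempty) H₀ H) :
    ∃ (v : Corner) (p : G.Walk v v), p.IsCircuit ∧
      ∀ e, e ∈ p.edges ↔ ∃ H ∈ 𝒞, e ∈ H.edgeSet := by
  classical
  set P : Set G.Subgraph → Prop := fun S => ∃ (v : Corner) (p : G.Walk v v), p.IsCircuit ∧
      ∀ e, e ∈ p.edges ↔ ∃ H ∈ S, e ∈ H.edgeSet with hP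
  have hfam : {S | S ⊆ 𝒞 ∧ H₀ ∈ S ∧ P S}.Finite :=
    hfin.finite_subsets.subset fun S hS => hS.1
  -- Take a maximal subfamily containing `H₀` that is traversed by a circuit; it will turn out to be
  -- closed under touching.
  obtain ⟨S, ⟨hS𝒞, hS₀, hSP⟩, hmax⟩ := hfam.exists_maximal (by
    obtain ⟨v, p, hp, he⟩ := hcyc H₀ h₀
    refine ⟨{H₀}, by simpa using h₀, rfl, v, p, hp.isCircuit, fun e => ?_⟩
    simp [← he])
  have hstay : ∀ K ∈ S, ∀ K' ∈ 𝒞, (K.verts ∩ K'.verts).Nonempty → K' ∈ S := by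
    rintro K hK K' hK' ⟨x, hxK, hxK'⟩
    by_contra hK'S
    obtain ⟨v, p, hp, he⟩ := hSP
    obtain ⟨e, heK, hxe⟩ := ((hcyc K (hS𝒞 hK)).mem_verts_iff x).1 hxK
    have hx : x ∈ p.support :=
      SimpleGraph.Walk.mem_support_iff_exists_mem_edges.2 (Or.inr ⟨e, (he e).2 ⟨K, hK, heK⟩, hxe⟩)
    obtain ⟨w, q, hq, hqK⟩ := hcyc K' hK'
    have hx' : x ∈ q.support := by rwa [← SimpleGraph.Walk.mem_verts_toSubgraph, hqK]
    have hpe : ∀ e, e ∈ (p.rotate x hx).edges ↔ ∃ H ∈ S, e ∈ H.edgeSet := fun e => by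
      rw [← he e]; exact (p.rotate_edges x hx).mem_iff
    have hqe : ∀ e, e ∈ (q.rotate x hx').edges ↔ e ∈ K'.edgeSet := fun e => by
      rw [← hqK, SimpleGraph.Walk.mem_edges_toSubgraph]; exact (q.rotate_edges x hx').mem_iff
    have hpc := hp.rotate hx
    have hqc := hq.rotate hx'
    -- Start the circuit and the new cycle at the common vertex `x` and run through one after the
    -- other; they have no common edge.
    refine hK'S (hmax (y := insert K' S) ⟨?_, Or.inr hS₀, x,
      (p.rotate x hx).append (q.rotate x hx'), ?_, fun e => ?_⟩ (Set.subset_insert _ _)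
      (Set.mem_insert _ _))
    · exact Set.insert_subset hK' hS𝒞
    · refine ⟨?_, ?_⟩
      · rw [SimpleGraph.Walk.isTrail_append]
        refine ⟨hpc.isTrail, hqc.isTrail, fun e h h' => ?_⟩
        obtain ⟨H, hH, heH⟩ := (hpe e).1 h
        exact hdisj H (hS𝒞 hH) K' hK' (fun h => hK'S (h ▸ hH)) e heH ((hqe e).1 h')
      · intro h
        have := congrArg SimpleGraph.Walk.length h
        rw [SimpleGraph.Walk.length_append] at this
        have h3 := hqc.three_le_length
        simp only [SimpleGraph.Walk.length_nil] at this
        omega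
    · rw [SimpleGraph.Walk.edges_append, List.mem_append, hpe, hqe]
      simp [or_comm]
  have hall : S = 𝒞 := by
    refine hS𝒞.antisymm fun H hH => ?_
    have hr := hconn H hH
    clear hH
    induction hr with
    | refl => exact hS₀
    | tail _ h ih => exact hstay _ ih _ h.1 h.2
  exact hall ▸ hSP

/-- The union of a family of cycles that is traversed by a circuit is connected. -/
lemma connected_sSup_of_isCircuit {G : SimpleGraph Corner} {𝒞 : Set G.Subgraph}
    (hcyc : ∀ H ∈ 𝒞, IsCycle H) {v : Corner} {p : G.Walk v v} (hp : p.IsCircuit)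
    (h : ∀ e, e ∈ p.edges ↔ ∃ H ∈ 𝒞, e ∈ H.edgeSet) : (sSup 𝒞).Connected := by
  have heq : sSup 𝒞 = p.toSubgraph := by
    refine subgraph_eq_of_edgeSet_eq (fun x => ?_) (fun x => ?_) ?_
    · simp only [SimpleGraph.Subgraph.verts_sSup, SimpleGraph.Subgraph.edgeSet_sSup,
        Set.mem_iUnion, exists_prop]
      constructor
      · rintro ⟨H, hH, hx⟩
        obtain ⟨e, he, hxe⟩ := ((hcyc H hH).mem_verts_iff x).1 hx
        exact ⟨e, ⟨H, hH, he⟩, hxe⟩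
      · rintro ⟨e, ⟨H, hH, he⟩, hxe⟩
        exact ⟨H, hH, ((hcyc H hH).mem_verts_iff x).2 ⟨e, he, hxe⟩⟩
    · rw [SimpleGraph.Walk.mem_verts_toSubgraph,
        SimpleGraph.Walk.mem_support_iff_exists_mem_edges_of_not_nil hp.not_nil]
      simp
    · ext e
      rw [SimpleGraph.Walk.mem_edges_toSubgraph, h]
      simp
  rw [heq]
  exact p.toSubgraph_connected

/-! ### The outermost cycles and their connectedness -/

lemma mem_corners_iff {v : Corner} {k : Square} : v ∈ corners k ↔
    k = (v.1, v.2) ∨ k = (v.1 - 1, v.2) ∨ k = (v.1 - 1, v.2 - 1) ∨ k = (v.1, v.2 - 1) := by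
  obtain ⟨a, b⟩ := v
  obtain ⟨i, j⟩ := k
  simp only [corners, Set.mem_insert_iff, Set.mem_singleton_iff, Prod.mk.injEq]
  omega

/-- At a corner that is on no boundary edge of `A`, all or none of the squares are in `A`. -/
lemma mem_iff_of_mem_corners {A : Set Square} {v : Corner} (h : ∀ e ∈ edgeBoundary A, v ∉ e)
    {k l : Square} (hk : v ∈ corners k) (hl : v ∈ corners l) : k ∈ A ↔ l ∈ A := by
  obtain ⟨a, b⟩ := v
  have h1 := fun h' => h (hEdge a b) h' (by simp [hEdge])
  have h2 := fun h' => h (hEdge (a - 1) b) h' (by simp [hEdge])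
  have h3 := fun h' => h (vEdge a b) h' (by simp [vEdge])
  rw [imp_false, hEdge_mem_edgeBoundary, not_not] at h1 h2
  rw [imp_false, vEdge_mem_edgeBoundary, not_not] at h3
  rw [mem_corners_iff] at hk hl
  rcases hk with rfl | rfl | rfl | rfl <;> rcases hl with rfl | rfl | rfl | rfl <;> grind

/-- The cycles around the squares of the component. -/
def outermostCycles (occ : Set Square) : Set (compGraph occ).Subgraph :=
  {H | IsCycle H ∧ ∃ k ∈ component occ, H.edgeSet = edgeBoundary (cell occ k)}

lemma outermostCycles_finite (hfin : (component occ).Finite) : (outermostCycles occ).Finite := by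
  refine Set.Finite.of_finite_image (f := fun H => H.edgeSet) ?_
    fun H hH H' hH' h => hH.1.eq_of_edgeSet_eq hH'.1 h
  refine (hfin.image fun k => edgeBoundary (cell occ k)).subset ?_
  rintro _ ⟨H, ⟨-, k, hk, h⟩, rfl⟩
  exact ⟨k, hk, h.symm⟩

lemma outermostCycles_disjoint {H H' : (compGraph occ).Subgraph} (hH : H ∈ outermostCycles occ)
    (hH' : H' ∈ outermostCycles occ) (hne : H ≠ H') : ∀ e ∈ H.edgeSet, e ∉ H'.edgeSet := by
  obtain ⟨hc, k, hk, he⟩ := hH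
  obtain ⟨hc', k', hk', he'⟩ := hH'
  intro e h h'
  refine hne (hc.eq_of_edgeSet_eq hc' ?_)
  rw [he] at h
  rw [he'] at h'
  rw [he, he', cell_eq_of_mem_edgeBoundary (not_mem_outer_of_mem_component hk)
    (not_mem_outer_of_mem_component hk') h h']

/-- Cycles around star-adjacent squares are equal or share a vertex. -/
lemma inter_verts_nonempty_of_corners {H H' : (compGraph occ).Subgraph} (hH : IsCycle H)
    (hH' : IsCycle H') {k l : Square} (he : H.edgeSet = edgeBoundary (cell occ k))
    (he' : H'.edgeSet = edgeBoundary (cell occ l)) (h : (corners k ∩ corners l).Nonempty) :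
    (H.verts ∩ H'.verts).Nonempty := by
  obtain ⟨v, hv, hv'⟩ := h
  by_cases heq : cell occ k = cell occ l
  · rw [hH.eq_of_edgeSet_eq hH' (by rw [he, he', heq]), Set.inter_self]
    obtain ⟨e, h⟩ := hH'.edgeSet_nonempty
    induction e with
    | h x y => exact ⟨x, (hH'.mem_verts_iff x).2 ⟨_, h, by simp⟩⟩
  -- If the common corner `v` were on no boundary edge of one of the cells, all squares around `v`
  -- would lie in that cell, and the two cells would coincide.
  · refine ⟨v, ?_, ?_⟩
    · rw [hH.mem_verts_iff, he]
      by_contra! hcon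
      exact heq (region_eq ((mem_iff_of_mem_corners hcon hv hv').1 (mem_region_self _ k)))
    · rw [hH'.mem_verts_iff, he']
      by_contra! hcon
      exact heq (region_eq ((mem_iff_of_mem_corners hcon hv hv').2 (mem_region_self _ l))).symm

/-- Along a chain of star-adjacent squares starting at the origin, the cycles of consecutive squares
share a vertex, so every cycle is linked to that of the origin. -/
lemma exists_isCircuit_outermostCycles (hfin : (component occ).Finite)
    (hne : (component occ).Nonempty) :
    ∃ (v : Corner) (p : (compGraph occ).Walk v v), p.IsCircuit ∧
      ∀ e, e ∈ p.edges ↔ ∃ H ∈ outermostCycles occ, e ∈ H.edgeSet := by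
  have h0 : (0 : Square) ∈ component occ := by
    obtain ⟨k, hk⟩ := hne
    exact ⟨hk.1, Relation.ReflTransGen.refl⟩
  have hex : ∀ k ∈ component occ, ∃ H ∈ outermostCycles occ,
      H.edgeSet = edgeBoundary (cell occ k) := fun k hk => by
    obtain ⟨H, hH, he⟩ := exists_isCycle_edgeSet_eq hfin (not_mem_outer_of_mem_component hk)
    exact ⟨H, ⟨hH, k, hk, he⟩, he⟩
  obtain ⟨H₀, hH₀, he₀⟩ := hex 0 h0
  refine exists_isCircuit_of_touching (outermostCycles_finite hfin) (fun H hH => hH.1)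
    (fun H hH H' hH' => outermostCycles_disjoint hH hH') hH₀ ?_
  have key : ∀ k, Relation.ReflTransGen (fun a b => a ∈ occ ∧ b ∈ occ ∧ StarAdj a b) 0 k →
      ∀ H ∈ outermostCycles occ, H.edgeSet = edgeBoundary (cell occ k) →
      Relation.ReflTransGen
        (fun K K' => K' ∈ outermostCycles occ ∧ (K.verts ∩ K'.verts).Nonempty) H₀ H := by
    intro k hk
    induction hk with
    | refl =>
      intro H hH he
      rw [hH.1.eq_of_edgeSet_eq hH₀.1 (he.trans he₀.symm)]
    | @tail l m hl hlm ih =>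
      intro H hH he
      obtain ⟨H', hH', he'⟩ := hex l ⟨h0.1, hl⟩
      exact (ih H' hH' he').tail
        ⟨hH, inter_verts_nonempty_of_corners hH'.1 hH.1 he' he hlm.2.2.2⟩
  intro H hH
  obtain ⟨-, k, hk, he⟩ := id hH
  exact key k hk.2 H hH he

/-! ### Squares and edges as subsets of the plane -/

/-- The closed unit square with centre `(i, j)`. -/
def closedSquare (k : Square) : Set Plane :=
  Set.Icc ((k.1 : ℝ) - 1 / 2) ((k.1 : ℝ) + 1 / 2) ×ˢ
    Set.Icc ((k.2 : ℝ) - 1 / 2) ((k.2 : ℝ) + 1 / 2)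

/-- The centre of a square. -/
def center (k : Square) : Plane := ((k.1 : ℝ), (k.2 : ℝ))

lemma closedEdge_hEdge (a b : ℤ) :
    closedEdge (hEdge a b) = Set.Icc ((a : ℝ) - 1 / 2) (a + 1 / 2) ×ˢ {(b : ℝ) - 1 / 2} := by
  change segment ℝ ((a : ℝ) - 1 / 2, (b : ℝ) - 1 / 2) (((a + 1 : ℤ) : ℝ) - 1 / 2, (b : ℝ) - 1 / 2) = _
  rw [← Prod.image_mk_segment_left, segment_eq_Icc (by push_cast; linarith), Set.prod_singleton]
  congr 2
  push_cast; ring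

lemma closedEdge_vEdge (a b : ℤ) :
    closedEdge (vEdge a b) = {(a : ℝ) - 1 / 2} ×ˢ Set.Icc ((b : ℝ) - 1 / 2) (b + 1 / 2) := by
  change segment ℝ ((a : ℝ) - 1 / 2, (b : ℝ) - 1 / 2) ((a : ℝ) - 1 / 2, ((b + 1 : ℤ) : ℝ) - 1 / 2) = _
  rw [← Prod.image_mk_segment_right, segment_eq_Icc (by push_cast; linarith), Set.singleton_prod]
  congr 2
  push_cast; ring

lemma openEdge_hEdge (a b : ℤ) :
    openEdge (hEdge a b) = Set.Ioo ((a : ℝ) - 1 / 2) (a + 1 / 2) ×ˢ {(b : ℝ) - 1 / 2} := by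
  change openSegment ℝ ((a : ℝ) - 1 / 2, (b : ℝ) - 1 / 2)
    (((a + 1 : ℤ) : ℝ) - 1 / 2, (b : ℝ) - 1 / 2) = _
  rw [← Prod.image_mk_openSegment_left, openSegment_eq_Ioo (by push_cast; linarith),
    Set.prod_singleton]
  congr 2
  push_cast; ring

lemma openEdge_vEdge (a b : ℤ) :
    openEdge (vEdge a b) = {(a : ℝ) - 1 / 2} ×ˢ Set.Ioo ((b : ℝ) - 1 / 2) (b + 1 / 2) := by
  change openSegment ℝ ((a : ℝ) - 1 / 2, (b : ℝ) - 1 / 2)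
    ((a : ℝ) - 1 / 2, ((b + 1 : ℤ) : ℝ) - 1 / 2) = _
  rw [← Prod.image_mk_openSegment_right, openSegment_eq_Ioo (by push_cast; linarith),
    Set.singleton_prod]
  congr 2
  push_cast; ring

lemma openSquare_disjoint_closedEdge {e : Sym2 Corner} (he : IsLatticeEdge e) (k : Square)
    {x : Plane} (hx : x ∈ openSquare k) : x ∉ closedEdge e := by
  obtain ⟨⟨h1, h2⟩, h3, h4⟩ := hx
  rcases he.cases with ⟨a, b, rfl⟩ | ⟨a, b, rfl⟩
  · rw [closedEdge_hEdge]
    rintro ⟨-, h : x.2 = _⟩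
    rw [h] at h3 h4
    have h5 : (k.2 : ℝ) < b := by linarith
    have h6 : (b : ℝ) < k.2 + 1 := by linarith
    norm_cast at h5 h6
    omega
  · rw [closedEdge_vEdge]
    rintro ⟨h : x.1 = _, -⟩
    rw [h] at h1 h2
    have h5 : (k.1 : ℝ) < a := by linarith
    have h6 : (a : ℝ) < k.1 + 1 := by linarith
    norm_cast at h5 h6
    omega

lemma openEdge_disjoint_closedEdge {e e' : Sym2 Corner} (he : IsLatticeEdge e)
    (he' : IsLatticeEdge e') (hne : e ≠ e') {x : Plane} (hx : x ∈ openEdge e) :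
    x ∉ closedEdge e' := by
  intro hx'
  rcases he.cases with ⟨a, b, rfl⟩ | ⟨a, b, rfl⟩ <;> rcases he'.cases with ⟨c, d, rfl⟩ | ⟨c, d, rfl⟩
  · rw [openEdge_hEdge] at hx
    rw [closedEdge_hEdge] at hx'
    obtain ⟨⟨h1, h2⟩, h3 : x.2 = _⟩ := hx
    obtain ⟨⟨h1', h2'⟩, h3' : x.2 = _⟩ := hx'
    have h4 : (b : ℝ) = d := by linarith
    have h5 : (a : ℝ) < c + 1 := by linarith
    have h6 : (c : ℝ) < a + 1 := by linarith
    norm_cast at h4 h5 h6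
    exact hne (hEdge_inj.2 ⟨by omega, h4⟩)
  · rw [openEdge_hEdge] at hx
    rw [closedEdge_vEdge] at hx'
    obtain ⟨⟨h1, h2⟩, -⟩ := hx
    obtain ⟨h3 : x.1 = _, -⟩ := hx'
    have h5 : (a : ℝ) < c := by linarith
    have h6 : (c : ℝ) < a + 1 := by linarith
    norm_cast at h5 h6
    omega
  · rw [openEdge_vEdge] at hx
    rw [closedEdge_hEdge] at hx'
    obtain ⟨-, ⟨h1, h2⟩⟩ := hx
    obtain ⟨-, h3 : x.2 = _⟩ := hx'
    have h5 : (b : ℝ) < d := by linarith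
    have h6 : (d : ℝ) < b + 1 := by linarith
    norm_cast at h5 h6
    omega
  · rw [openEdge_vEdge] at hx
    rw [closedEdge_vEdge] at hx'
    obtain ⟨h3 : x.1 = _, ⟨h1, h2⟩⟩ := hx
    obtain ⟨h3' : x.1 = _, ⟨h1', h2'⟩⟩ := hx'
    have h4 : (a : ℝ) = c := by linarith
    have h5 : (b : ℝ) < d + 1 := by linarith
    have h6 : (d : ℝ) < b + 1 := by linarith
    norm_cast at h4 h5 h6
    exact hne (vEdge_inj.2 ⟨h4, by omega⟩)

lemma openEdge_nonempty {e : Sym2 Corner} (he : IsLatticeEdge e) : (openEdge e).Nonempty := by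
  rcases he.cases with ⟨a, b, rfl⟩ | ⟨a, b, rfl⟩
  · rw [openEdge_hEdge]
    exact (Set.nonempty_Ioo.2 (by linarith)).prod (Set.singleton_nonempty _)
  · rw [openEdge_vEdge]
    exact (Set.singleton_nonempty _).prod (Set.nonempty_Ioo.2 (by linarith))

lemma closedEdge_subset_closedSquare {e : Sym2 Corner} {k : Square} (h : e ∈ squareEdges k) :
    closedEdge e ⊆ closedSquare k := by
  rcases mem_squareEdges_iff.1 h with rfl | rfl | rfl | rfl
  all_goals
    first | rw [closedEdge_hEdge] | rw [closedEdge_vEdge]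
    refine Set.prod_mono ?_ ?_ <;> intro x hx <;>
      simp only [Set.mem_Icc, Set.mem_singleton_iff] at hx ⊢ <;> push_cast at hx ⊢ <;>
      constructor <;> linarith

lemma openEdge_subset_closedEdge {e : Sym2 Corner} : openEdge e ⊆ closedEdge e := by
  induction e with
  | h u v => exact openSegment_subset_segment ℝ _ _

lemma closure_openSquare (k : Square) : closure (openSquare k) = closedSquare k := by
  rw [openSquare, closure_prod_eq, closure_Ioo (by linarith), closure_Ioo (by linarith)]
  rfl

lemma openSquare_subset_closedSquare (k : Square) : openSquare k ⊆ closedSquare k :=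
  closure_openSquare k ▸ subset_closure

lemma isPreconnected_openSquare (k : Square) : IsPreconnected (openSquare k) :=
  isPreconnected_Ioo.prod isPreconnected_Ioo

lemma center_mem_openSquare (k : Square) : center k ∈ openSquare k := by
  simp only [center, openSquare, Set.mem_prod, Set.mem_Ioo]
  refine ⟨⟨?_, ?_⟩, ?_, ?_⟩ <;> linarith

/-! ### Components of the complement of a lattice subgraph -/

section Complement

variable {G : SimpleGraph Corner} {H : G.Subgraph}

/-- The connected component of a square in the complement of a subgraph. -/
def squareComponent (H : G.Subgraph) (k : Square) : Set Plane :=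
  connectedComponentIn (trace H)ᶜ (center k)

lemma mem_trace {x : Plane} : x ∈ trace H ↔ ∃ e ∈ H.edgeSet, x ∈ closedEdge e := by
  simp [trace]

lemma not_mem_trace_of_mem_openSquare (hH : ∀ e ∈ H.edgeSet, IsLatticeEdge e) {k : Square}
    {x : Plane} (hx : x ∈ openSquare k) : x ∉ trace H := by
  rw [mem_trace]
  rintro ⟨e, he, hxe⟩
  exact openSquare_disjoint_closedEdge (hH e he) k hx hxe

lemma not_mem_trace_of_mem_openEdge (hH : ∀ e ∈ H.edgeSet, IsLatticeEdge e) {e : Sym2 Corner}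
    (he : IsLatticeEdge e) (heH : e ∉ H.edgeSet) {x : Plane} (hx : x ∈ openEdge e) :
    x ∉ trace H := by
  rw [mem_trace]
  rintro ⟨e', he', hxe⟩
  exact openEdge_disjoint_closedEdge he (hH e' he') (fun h => heH (h ▸ he')) hx hxe

lemma connectedComponentIn_eq_squareComponent (hH : ∀ e ∈ H.edgeSet, IsLatticeEdge e) {k : Square}
    {x : Plane} (hx : x ∈ closedSquare k) (hxH : x ∉ trace H) :
    connectedComponentIn (trace H)ᶜ x = squareComponent H k := by
  -- An open square stays connected when a point of its closure is added.
  have hpre : IsPreconnected (insert x (openSquare k)) :=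
    (isPreconnected_openSquare k).subset_closure (Set.subset_insert _ _)
      (Set.insert_subset (closure_openSquare k ▸ hx) subset_closure)
  refine connectedComponentIn_eq (hpre.subset_connectedComponentIn (Set.mem_insert _ _) ?_
    (Set.mem_insert_of_mem _ (center_mem_openSquare k)))
  exact Set.insert_subset hxH fun y hy => not_mem_trace_of_mem_openSquare hH hy

lemma center_mem_squareComponent (hH : ∀ e ∈ H.edgeSet, IsLatticeEdge e) (k : Square) :
    center k ∈ squareComponent H k :=
  mem_connectedComponentIn (not_mem_trace_of_mem_openSquare hH (center_mem_openSquare k))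

lemma squareComponent_eq_of_step (hH : ∀ e ∈ H.edgeSet, IsLatticeEdge e) {k l : Square}
    {D : Set (Sym2 Corner)} (hD : H.edgeSet ⊆ D) (h : Step D k l) :
    squareComponent H k = squareComponent H l := by
  obtain ⟨e, he, hk, hl⟩ := h
  have hlat : IsLatticeEdge e := ⟨k, hk⟩
  obtain ⟨x, hx⟩ := openEdge_nonempty hlat
  have hxH := not_mem_trace_of_mem_openEdge hH hlat (fun h => he (hD h)) hx
  have hx := openEdge_subset_closedEdge hx
  rw [← connectedComponentIn_eq_squareComponent hH (closedEdge_subset_closedSquare hk hx) hxH,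
    ← connectedComponentIn_eq_squareComponent hH (closedEdge_subset_closedSquare hl hx) hxH]

lemma squareComponent_eq_of_reach (hH : ∀ e ∈ H.edgeSet, IsLatticeEdge e) {k l : Square}
    {D : Set (Sym2 Corner)} (hD : H.edgeSet ⊆ D) (h : Reach D k l) :
    squareComponent H k = squareComponent H l := by
  induction h with
  | refl => rfl
  | tail _ h ih => rw [ih, squareComponent_eq_of_step hH hD h]

lemma mem_cycleInterior_iff (hH : ∀ e ∈ H.edgeSet, IsLatticeEdge e) {k : Square} {x : Plane}
    (hx : x ∈ closedSquare k) :
    x ∈ cycleInterior H ↔ x ∉ trace H ∧ Bornology.IsBounded (squareComponent H k) :=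
  and_congr_right fun h => by rw [connectedComponentIn_eq_squareComponent hH hx h]

lemma mem_cycleExterior_iff (hH : ∀ e ∈ H.edgeSet, IsLatticeEdge e) {k : Square} {x : Plane}
    (hx : x ∈ closedSquare k) :
    x ∈ cycleExterior H ↔ x ∉ trace H ∧ ¬ Bornology.IsBounded (squareComponent H k) :=
  and_congr_right fun h => by rw [connectedComponentIn_eq_squareComponent hH hx h]

lemma openSquare_subset_cycleInterior (hH : ∀ e ∈ H.edgeSet, IsLatticeEdge e) {k : Square} :
    openSquare k ⊆ cycleInterior H ↔ Bornology.IsBounded (squareComponent H k) := by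
  constructor
  · intro h
    exact ((mem_cycleInterior_iff hH (openSquare_subset_closedSquare k (center_mem_openSquare k))).1
      (h (center_mem_openSquare k))).2
  · intro h x hx
    exact (mem_cycleInterior_iff hH (openSquare_subset_closedSquare k hx)).2
      ⟨not_mem_trace_of_mem_openSquare hH hx, h⟩

lemma openSquare_subset_cycleExterior (hH : ∀ e ∈ H.edgeSet, IsLatticeEdge e) {k : Square}
    (h : ¬ Bornology.IsBounded (squareComponent H k)) : openSquare k ⊆ cycleExterior H :=
  fun _ hx => (mem_cycleExterior_iff hH (openSquare_subset_closedSquare k hx)).2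
    ⟨not_mem_trace_of_mem_openSquare hH hx, h⟩

lemma finite_center_mem {S : Set Plane} (hS : Bornology.IsBounded S) : {k | center k ∈ S}.Finite := by
  obtain ⟨R, hR⟩ := hS.subset_closedBall 0
  obtain ⟨N, hN⟩ := exists_nat_ge R
  refine ((Set.finite_Icc (-N : ℤ) N).prod (Set.finite_Icc (-N : ℤ) N)).subset fun k hk => ?_
  have h := hR hk
  rw [mem_closedBall_zero_iff] at h
  have h1 : |(k.1 : ℝ)| ≤ N := ((norm_fst_le (center k)).trans h).trans hN
  have h2 : |(k.2 : ℝ)| ≤ N := ((norm_snd_le (center k)).trans h).trans hN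
  rw [abs_le] at h1 h2
  exact ⟨⟨by exact_mod_cast h1.1, by exact_mod_cast h1.2⟩,
    ⟨by exact_mod_cast h2.1, by exact_mod_cast h2.2⟩⟩

/-- The component contains the centres of all squares of the region, and a bounded set contains only
finitely many centres. -/
lemma not_isBounded_of_infinite_region (hH : ∀ e ∈ H.edgeSet, IsLatticeEdge e)
    {D : Set (Sym2 Corner)} (hD : H.edgeSet ⊆ D) {k : Square} (h : (region D k).Infinite) :
    ¬ Bornology.IsBounded (squareComponent H k) := by
  refine fun hb => h ((finite_center_mem hb).subset fun l hl => ?_)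
  change center l ∈ squareComponent H k
  rw [squareComponent_eq_of_reach hH hD hl]
  exact center_mem_squareComponent hH l

lemma point_mem_closedEdge {v : Corner} {e : Sym2 Corner} (h : v ∈ e) :
    Corner.point v ∈ closedEdge e := by
  obtain ⟨w, rfl⟩ := h
  exact left_mem_segment ℝ _ _

/-- Closed squares inside and outside of `A` only meet on boundary edges of `A`. -/
lemma exists_mem_closedEdge {A : Set Square} {k l : Square} (hk : k ∈ A) (hl : l ∉ A) {x : Plane}
    (hxk : x ∈ closedSquare k) (hxl : x ∈ closedSquare l) :
    ∃ e ∈ edgeBoundary A, x ∈ closedEdge e := by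
  have hkl : k ≠ l := fun h => hl (h ▸ hk)
  have hbd : ∀ e, e ∈ squareEdges k → e ∈ squareEdges l → e ∈ edgeBoundary A := fun e h h' =>
    (mem_edgeBoundary_iff h h' hkl).2 fun h => hl (h.1 hk)
  -- Squares that touch only in a corner: if this corner were on no boundary edge, both squares
  -- would be in `A` or neither.
  have hcorner : ∀ v, v ∈ corners k → v ∈ corners l → Corner.point v = x →
      ∃ e ∈ edgeBoundary A, x ∈ closedEdge e := by
    rintro v hv hv' rfl
    by_contra! hcon
    exact hl ((mem_iff_of_mem_corners
      (fun e he hve => hcon e he (point_mem_closedEdge hve)) hv hv').1 hk)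
  obtain ⟨i, j⟩ := k
  obtain ⟨m, n⟩ := l
  obtain ⟨x, y⟩ := x
  obtain ⟨⟨h1, h2⟩, h3, h4⟩ := hxk
  obtain ⟨⟨h1', h2'⟩, h3', h4'⟩ := hxl
  simp only at h1 h2 h3 h4 h1' h2' h3' h4'
  have a1 : (i : ℝ) ≤ m + 1 := by linarith
  have a2 : (m : ℝ) ≤ i + 1 := by linarith
  have a3 : (j : ℝ) ≤ n + 1 := by linarith
  have a4 : (n : ℝ) ≤ j + 1 := by linarith
  norm_cast at a1 a2 a3 a4
  have hm : m = i ∨ m = i + 1 ∨ i = m + 1 := by omega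
  have hn : n = j ∨ n = j + 1 ∨ j = n + 1 := by omega
  rcases hm with rfl | rfl | rfl <;> rcases hn with rfl | rfl | rfl <;> push_cast at *
  · exact absurd rfl hkl
  · refine ⟨_, hbd (hEdge m (j + 1)) (by simp) (by simp), ?_⟩
    rw [closedEdge_hEdge]
    exact ⟨⟨h1, h2⟩, by push_cast; exact le_antisymm (by linarith) (by linarith)⟩
  · refine ⟨_, hbd (hEdge m (n + 1)) (by simp) (by simp), ?_⟩
    rw [closedEdge_hEdge]
    exact ⟨⟨h1, h2⟩, by push_cast; exact le_antisymm (by linarith) (by linarith)⟩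
  · refine ⟨_, hbd (vEdge (i + 1) n) (by simp) (by simp), ?_⟩
    rw [closedEdge_vEdge]
    exact ⟨by push_cast; exact le_antisymm (by linarith) (by linarith), ⟨h3, h4⟩⟩
  · refine hcorner (i + 1, j + 1) (by simp [mem_corners_iff]) (by simp [mem_corners_iff]) ?_
    refine Prod.ext ?_ ?_ <;> simp only [Corner.point] <;> push_cast <;> linarith
  · refine hcorner (i + 1, n + 1) (by simp [mem_corners_iff]) (by simp [mem_corners_iff]) ?_
    refine Prod.ext ?_ ?_ <;> simp only [Corner.point] <;> push_cast <;> linarith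
  · refine ⟨_, hbd (vEdge (m + 1) n) (by simp) (by simp), ?_⟩
    rw [closedEdge_vEdge]
    exact ⟨by push_cast; exact le_antisymm (by linarith) (by linarith), ⟨h3, h4⟩⟩
  · refine hcorner (m + 1, j + 1) (by simp [mem_corners_iff]) (by simp [mem_corners_iff]) ?_
    refine Prod.ext ?_ ?_ <;> simp only [Corner.point] <;> push_cast <;> linarith
  · refine hcorner (m + 1, n + 1) (by simp [mem_corners_iff]) (by simp [mem_corners_iff]) ?_
    refine Prod.ext ?_ ?_ <;> simp only [Corner.point] <;> push_cast <;> linarith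

lemma exists_closedSquare_mem (x : Plane) : ∃ k, x ∈ closedSquare k := by
  refine ⟨(round x.1, round x.2), ?_⟩
  have h1 := abs_le.1 (abs_sub_round x.1)
  have h2 := abs_le.1 (abs_sub_round x.2)
  refine ⟨⟨?_, ?_⟩, ?_, ?_⟩ <;> simp only <;> linarith

lemma isClosed_closedSquare (k : Square) : IsClosed (closedSquare k) :=
  closure_openSquare k ▸ isClosed_closure

lemma locallyFinite_closedSquare : LocallyFinite closedSquare := by
  intro x
  refine ⟨Metric.closedBall x 1, Metric.closedBall_mem_nhds x one_pos, ?_⟩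
  -- A centre is within distance 1 of every point of its closed square, hence within 2 of `x` if
  -- that square meets the ball of radius 1.
  refine (finite_center_mem (Metric.isBounded_closedBall (x := x) (r := 2))).subset ?_
  rintro k ⟨y, ⟨⟨h1, h2⟩, h3, h4⟩, hy⟩
  have h : dist (center k) y ≤ 1 := by
    rw [Prod.dist_eq, Real.dist_eq, Real.dist_eq]
    refine max_le ?_ ?_ <;> rw [abs_le] <;> simp only [center] <;> constructor <;> linarith
  change dist (center k) x ≤ 2
  have := dist_triangle (center k) y x
  have := Metric.mem_closedBall.1 hy
  linarith

/-- The squares of a finite set are in bounded components of the complement of a subgraph that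
contains its boundary edges. -/
lemma isBounded_squareComponent (hH : ∀ e ∈ H.edgeSet, IsLatticeEdge e) {A : Set Square}
    (hA : A.Finite) (h : edgeBoundary A ⊆ H.edgeSet) {k : Square} (hk : k ∈ A) :
    Bornology.IsBounded (squareComponent H k) := by
  have hbd : Bornology.IsBounded (⋃ m ∈ A, closedSquare m) := by
    rw [Bornology.isBounded_biUnion hA]
    exact fun m _ => (Metric.isBounded_Icc _ _).prod (Metric.isBounded_Icc _ _)
  refine hbd.subset fun y hy => ?_
  by_contra hyA
  have hc : ∀ B : Set Square, IsClosed (⋃ m ∈ B, closedSquare m) := fun B => by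
    rw [Set.biUnion_eq_iUnion]
    exact (locallyFinite_closedSquare.comp_injective Subtype.val_injective).isClosed_iUnion
      fun m => isClosed_closedSquare m
  have hcover : ∀ z, z ∉ ⋃ m ∈ A, closedSquare m → z ∈ ⋃ m ∈ Aᶜ, closedSquare m := fun z hz => by
    obtain ⟨m, hm⟩ := exists_closedSquare_mem z
    exact Set.mem_biUnion (fun hmA => hz (Set.mem_biUnion hmA hm)) hm
  -- The closed squares of `A` and those of its complement form two closed sets that cover the
  -- plane. A connected set meeting both has a point in their intersection, which consists of points
  -- on boundary edges of `A`.
  have hcon := isPreconnected_closed_iff.1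
    (isPreconnected_connectedComponentIn (x := center k) (F := (trace H)ᶜ)) _ _ (hc A) (hc Aᶜ)
    (fun z _ => or_iff_not_imp_left.2 (hcover z))
    ⟨center k, center_mem_squareComponent hH k,
      Set.mem_biUnion hk (openSquare_subset_closedSquare k (center_mem_openSquare k))⟩
    ⟨y, hy, hcover y hyA⟩
  obtain ⟨z, hz, hzA, hzA'⟩ := hcon
  simp only [Set.mem_iUnion, exists_prop] at hzA hzA'
  obtain ⟨m, hm, hzm⟩ := hzA
  obtain ⟨n, hn, hzn⟩ := hzA'
  obtain ⟨e, he, hze⟩ := exists_mem_closedEdge hm hn hzm hzn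
  exact connectedComponentIn_subset _ _ hz (mem_trace.2 ⟨e, h he, hze⟩)

end Complement

/-! ### Interior and exterior of the cycle of a cell -/

lemma isLatticeEdge_of_mem_subgraph (H : (compGraph occ).Subgraph) :
    ∀ e ∈ H.edgeSet, IsLatticeEdge e :=
  fun _ he => isLatticeEdge_of_mem_edgeSet (H.edgeSet_subset he)

/-- Outer squares lie outside of every cycle. -/
lemma not_isBounded_of_mem_outer (H : (compGraph occ).Subgraph) {l : Square} (hl : l ∈ outer occ) :
    ¬ Bornology.IsBounded (squareComponent H l) :=
  not_isBounded_of_infinite_region (isLatticeEdge_of_mem_subgraph H) H.edgeSet_subset hl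

section CellCycle

variable {H : (compGraph occ).Subgraph} {k : Square}

lemma isBounded_of_mem_cell (hfin : (component occ).Finite) (hk : k ∉ outer occ)
    (he : H.edgeSet = edgeBoundary (cell occ k)) {l : Square} (hl : l ∈ cell occ k) :
    Bornology.IsBounded (squareComponent H l) :=
  isBounded_squareComponent (isLatticeEdge_of_mem_subgraph H) (cell_finite hfin hk) he.ge hl

/-- A non-outer square can leave its own cell through a boundary edge to an outer square; this edge
is not on `H`, because cells with a common boundary edge are equal. -/
lemma not_isBounded_of_not_mem_cell (hfin : (component occ).Finite) (hk : k ∉ outer occ)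
    (he : H.edgeSet = edgeBoundary (cell occ k)) {l : Square} (hl : l ∉ cell occ k) :
    ¬ Bornology.IsBounded (squareComponent H l) := by
  have hlat := isLatticeEdge_of_mem_subgraph H
  by_cases hlo : l ∈ outer occ
  · exact not_isBounded_of_mem_outer H hlo
  · obtain ⟨e, hel⟩ := edgeBoundary_nonempty (cell_finite hfin hlo) ⟨l, mem_region_self _ l⟩
    obtain ⟨⟨m, -, hm, hme⟩, n, hn, hne⟩ := exists_of_mem_edgeBoundary_cell hlo hel
    have heH : e ∉ H.edgeSet := fun h => by
      rw [he] at h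
      exact hl (cell_eq_of_mem_edgeBoundary hlo hk hel h ▸ mem_region_self _ l)
    rw [squareComponent_eq_of_reach hlat (he.le.trans (edgeBoundary_cell_subset k)) hm,
      squareComponent_eq_of_step hlat subset_rfl ⟨e, heH, hme, hne⟩]
    exact not_isBounded_of_mem_outer H hn

lemma exists_mem_cell_of_mem_cycleInterior (hfin : (component occ).Finite) (hk : k ∉ outer occ)
    (he : H.edgeSet = edgeBoundary (cell occ k)) {x : Plane} (hx : x ∈ cycleInterior H)
    {l : Square} (hl : x ∈ closedSquare l) : l ∈ cell occ k := by
  by_contra h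
  exact not_isBounded_of_not_mem_cell hfin hk he h
    ((mem_cycleInterior_iff (isLatticeEdge_of_mem_subgraph H) hl).1 hx).2

end CellCycle

/-! ### The outermost boundary and existence of the cycles -/

/-- An edge of G_C that is not outer borders a square of the component and is not on the cycle of
its cell, so it lies in the interior of that cycle. An outer edge borders an outer square, which is
outside every cycle. -/
lemma outermostBoundary_eq (hfin : (component occ).Finite) :
    outermostBoundary occ = outerEdges occ := by
  ext e
  constructor
  · rintro ⟨he, h⟩
    by_contra heD
    obtain ⟨k, hk, hke⟩ := mem_edgeSet_compGraph.1 he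
    have hko := not_mem_outer_of_mem_component hk
    obtain ⟨H, hH, hHe⟩ := exists_isCycle_edgeSet_eq hfin hko
    rcases h H hH with h | h
    · exact heD (edgeBoundary_cell_subset k (hHe ▸ h))
    · obtain ⟨x, hx⟩ := openEdge_nonempty ⟨k, hke⟩
      exact ((mem_cycleExterior_iff (isLatticeEdge_of_mem_subgraph H)
        (closedEdge_subset_closedSquare hke (openEdge_subset_closedEdge hx))).1 (h hx)).2
        (isBounded_of_mem_cell hfin hko hHe (mem_region_self _ k))
  · intro he
    refine ⟨outerEdges_subset he, fun H _ => or_iff_not_imp_left.2 fun heH x hx => ?_⟩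
    obtain ⟨-, l, hl, hle⟩ := exists_of_mem_outerEdges he
    have hlat := isLatticeEdge_of_mem_subgraph H
    exact (mem_cycleExterior_iff hlat
      (closedEdge_subset_closedSquare hle (openEdge_subset_closedEdge hx))).2
      ⟨not_mem_trace_of_mem_openEdge hlat ⟨l, hle⟩ heH hx, not_isBounded_of_mem_outer H hl⟩

lemma isOutermostCycles_outermostCycles (hfin : (component occ).Finite) :
    IsOutermostCycles occ (outermostCycles occ) where
  finite := outermostCycles_finite hfin
  isCycle := fun H hH => hH.1
  boundary_eq := by
    rw [outermostBoundary_eq hfin]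
    ext e
    simp only [Set.mem_iUnion, exists_prop]
    constructor
    · intro he
      obtain ⟨⟨k, hk, hke⟩, -⟩ := exists_of_mem_outerEdges he
      have hko := not_mem_outer_of_mem_component hk
      obtain ⟨H, hH, hHe⟩ := exists_isCycle_edgeSet_eq hfin hko
      exact ⟨H, ⟨hH, k, hk, hHe⟩, hHe ▸ mem_edgeBoundary_cell hko he (mem_region_self _ k) hke⟩
    · rintro ⟨H, ⟨-, k, -, hHe⟩, he⟩
      exact edgeBoundary_cell_subset k (hHe ▸ he)
  connected := fun hne => by
    obtain ⟨v, p, hp, h⟩ := exists_isCircuit_outermostCycles hfin hne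
    exact connected_sSup_of_isCircuit (fun H hH => hH.1) hp h
  disjoint := by
    rintro H ⟨hH, k, hk, he⟩ H' ⟨hH', k', hk', he'⟩ hne
    have hko := not_mem_outer_of_mem_component hk
    have hko' := not_mem_outer_of_mem_component hk'
    refine ⟨Set.disjoint_left.2 fun x hx hx' => ?_,
      subsingleton_inter_verts hko hko' hH hH' he he' hne⟩
    obtain ⟨l, hl⟩ := exists_closedSquare_mem x
    have h1 := exists_mem_cell_of_mem_cycleInterior hfin hko he hx hl
    have h2 := exists_mem_cell_of_mem_cycleInterior hfin hko' he' hx' hl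
    exact hne (hH.eq_of_edgeSet_eq hH' (by
      rw [he, he', show cell occ k = cell occ k' from (region_eq h1).trans (region_eq h2).symm]))
  covers := fun k hk => by
    have hko := not_mem_outer_of_mem_component hk
    obtain ⟨H, hH, hHe⟩ := exists_isCycle_edgeSet_eq hfin hko
    exact ⟨H, ⟨hH, k, hk, hHe⟩, (openSquare_subset_cycleInterior
      (isLatticeEdge_of_mem_subgraph H)).2 (isBounded_of_mem_cell hfin hko hHe (mem_region_self _ k))⟩
  edges := by
    rintro H ⟨hH, k, hk, hHe⟩ e he
    have hko := not_mem_outer_of_mem_component hk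
    have hlat := isLatticeEdge_of_mem_subgraph H
    obtain ⟨⟨m, hm, hmk, hme⟩, l, hl, hle⟩ := exists_of_mem_edgeBoundary_cell hko (hHe ▸ he)
    have hlocc := not_occ_of_mem_outer hm hl hme hle
    exact ⟨⟨H.edgeSet_subset he, ⟨m, occ_of_mem_component hm, hme⟩, l, hlocc, hle⟩,
      ⟨m, hm, hme, (openSquare_subset_cycleInterior hlat).2
        (isBounded_of_mem_cell hfin hko hHe hmk)⟩,
      l, hlocc, hle, openSquare_subset_cycleExterior hlat (not_isBounded_of_mem_outer H hl)⟩

/-! ### Uniqueness of the cycles -/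

/-- In a family with the properties of the outermost cycles, a cycle around a square of the
component is the boundary of the cell of this square. -/
lemma IsOutermostCycles.edgeSet_eq (hfin : (component occ).Finite)
    {𝒞 : Set (compGraph occ).Subgraph} (h𝒞 : IsOutermostCycles occ 𝒞)
    {H : (compGraph occ).Subgraph} (hH : H ∈ 𝒞) {k : Square} (hk : k ∈ component occ)
    (hkH : openSquare k ⊆ cycleInterior H) : H.edgeSet = edgeBoundary (cell occ k) := by
  have hko := not_mem_outer_of_mem_component hk
  have hD : outerEdges occ = ⋃ H ∈ 𝒞, H.edgeSet := outermostBoundary_eq hfin ▸ h𝒞.boundary_eq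
  have hsub : edgeBoundary (cell occ k) ⊆ H.edgeSet := by
    intro e he
    have heD := edgeBoundary_cell_subset k he
    obtain ⟨H', hH', heH'⟩ : ∃ H' ∈ 𝒞, e ∈ H'.edgeSet := by simpa [hD] using heD
    have hH'D : H'.edgeSet ⊆ outerEdges occ := hD ▸ Set.subset_biUnion_of_mem hH'
    obtain ⟨-, ⟨k', hk', hke', hkH'⟩, -⟩ := h𝒞.edges H' hH' e heH'
    obtain ⟨⟨m, hm, hmk, hme⟩, -⟩ := exists_of_mem_edgeBoundary_cell hko he
    obtain rfl := eq_of_mem_outerEdges heD (not_mem_outer_of_mem_component hm)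
      (not_mem_outer_of_mem_component hk') hme hke'
    have hlat := isLatticeEdge_of_mem_subgraph H'
    -- The square of the component at `e` is inside `H'`, and so is `k`, which is in the same cell
    -- and thus not separated from it by `H'`. As `k` is also inside `H`, disjointness of interiors
    -- gives `H' = H`.
    rw [openSquare_subset_cycleInterior hlat,
      ← squareComponent_eq_of_reach hlat hH'D hmk,
      ← openSquare_subset_cycleInterior hlat] at hkH'
    by_contra hne
    exact Set.disjoint_left.1 (h𝒞.disjoint H hH H' hH' fun h => hne (h ▸ heH')).1
      (hkH (center_mem_openSquare k)) (hkH' (center_mem_openSquare k))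
  -- The boundary of the cell is itself a cycle, and a cycle contained in the cycle `H` is all of
  -- `H`.
  obtain ⟨K, hK, hKe⟩ := exists_isCycle_edgeSet_eq hfin hko
  rw [← hK.eq_of_edgeSet_subset (h𝒞.isCycle H hH) (hKe ▸ hsub), hKe]

/-- By (iv) each cycle of the family surrounds a square of the component, and by (iii) each such
square is surrounded by a cycle of the family; in both cases the cycle is the boundary of the cell.
-/
lemma IsOutermostCycles.eq_outermostCycles (hfin : (component occ).Finite)
    {𝒞 : Set (compGraph occ).Subgraph} (h𝒞 : IsOutermostCycles occ 𝒞) :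
    𝒞 = outermostCycles occ := by
  ext H
  constructor
  · intro hH
    obtain ⟨e, he⟩ := (h𝒞.isCycle H hH).edgeSet_nonempty
    obtain ⟨-, ⟨k, hk, -, hkH⟩, -⟩ := h𝒞.edges H hH e he
    exact ⟨h𝒞.isCycle H hH, k, hk, h𝒞.edgeSet_eq hfin hH hk hkH⟩
  · rintro ⟨hH, k, hk, hHe⟩
    obtain ⟨H', hH', hkH'⟩ := h𝒞.covers k hk
    rwa [hH.eq_of_edgeSet_eq (h𝒞.isCycle H' hH')
      (hHe.trans (h𝒞.edgeSet_eq hfin hH' hk hkH').symm)]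

end StarPercolation

theorem theorem1 (occ : Set StarPercolation.Square)
    (hfin : (StarPercolation.component occ).Finite) :
    ∃ 𝒞 : Set (StarPercolation.compGraph occ).Subgraph,
      StarPercolation.IsOutermostCycles occ 𝒞 ∧
      (∀ 𝒞' : Set (StarPercolation.compGraph occ).Subgraph,
        StarPercolation.IsOutermostCycles occ 𝒞' → 𝒞' = 𝒞) ∧
      ((StarPercolation.component occ).Nonempty →
        ∃ (v : StarPercolation.Corner) (p : (StarPercolation.compGraph occ).Walk v v),
          p.IsCircuit ∧ ∀ e, e ∈ p.edges ↔ ∃ H ∈ 𝒞, e ∈ H.edgeSet) :=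
  ⟨StarPercolation.outermostCycles occ,
    StarPercolation.isOutermostCycles_outermostCycles hfin,
    fun _ h𝒞 => h𝒞.eq_outermostCycles hfin,
    StarPercolation.exists_isCircuit_outermostCycles hfin⟩
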